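/- Let $M\ge 1$ and let $f_1,\dots,f_M$ be probability densities on $\mathbb{R}$ (with respect to Lebesgue measure). Put $f_m(x;\mu,\sigma)=\frac1\sigma f_m\!\left(\frac{x-\mu}{\sigma}\right)$ for $\mu\in\mathbb{R}$, $\sigma>0$; let $$\Theta=\Big\{\theta=(\alpha_m,\mu_m,\sigma_m)_{m=1}^M\in\mathbb{R}^{3M} : \alpha_m\ge 0,\ \sum_{m=1}^M\alpha_m=1,\ \sigma_m>0\Big\},\qquad f(x;\theta)=\sum_{m=1}^M\alpha_m f_m(x;\mu_m,\sigma_m),$$ with the Euclidean distance $\mathrm{dist}$ on $\Theta$. For $K\le M$ let $\mathscr{G}_K$ be the set of all functions $\sum_{m\in\mathscr{K}}\alpha_m f_m(x;\mu_m,\sigma_m)$ with $\theta\in\Theta$, $\mathscr{K}\subset\{1,\dots,M\}$, $|\mathscr{K}|\le K$. Here and below, densities that agree Lebesgue-almost everywhere are identified. For $\theta\in\Theta$ let $\Theta(\theta)=\{\theta'\in\Theta : f(x;\theta')=f(x;\theta)\text{ for almost every }x\}$, and for $U,V\subset\Theta$ let $\mathrm{dist}(U,V)=\inf_{\theta\in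 U}\inf_{\theta'\in V}\mathrm{dist}(\theta,\theta')$. Let $\theta_0\in\Theta$, $f_0=f(\cdot;\theta_0)$ and $\Theta_0=\Theta(\theta_0)$. Assume: 1. There are constants $v_0,v_1>0$ and $\beta>1$ with $f_m(x)\le\min\{v_0,\ v_1|x|^{-\beta}\}$ for all $m$ and all $x$ (at $x=0$ this means $f_m(0)\le v_0$). 2. For each $\theta\in\Theta$ and all sufficiently small $\rho>0$, the function $x\mapsto\sup\{f(x;\theta'):\theta'\in\Theta,\ \mathrm{dist}(\theta',\theta)\le\rho\}$ is measurable. 3. For each compact $\Gamma\subset\Theta$ and each $\theta\in\Gamma$ there is a Lebesgue null set $N$ such that $f(x;\theta^{(j)})\to f(x;\theta)$ for every $x\notin N$ and every sequence $\theta^{(j)}\in\Gamma$ with $\theta^{(j)}\to\theta$. 4. $\int|\log f_0(x)|\,f_0(x)\,dx<\infty$. Suppose $f_0\in\mathscr{G}_M\setminus\mathscr{G}_{M-1}$. Let $c_0>0$, $0<d<1$, $c_n=c_0\exp(-n^d)$ and $\Theta_n=\{\theta\in\Theta:\sigma_m\ge c_n,\ m=1,\dots,M\}$. Let $X_1,X_2,\dots$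 be independent random variables with density $f_0$, and let $\hat\theta_n$ be a maximum likelihood estimator restricted to $\Theta_n$, that is, a maximizer of $\theta\mapsto\prod_{i=1}^n f(X_i;\theta)$ over $\Theta_n$. Then, almost surely, if $\hat\theta_n$ is such a maximizer for all sufficiently large $n$, $$\lim_{n\to\infty}\mathrm{dist}\big(\Theta(\hat\theta_n),\Theta_0\big)=0 .$$ -/

import Mathlib

open MeasureTheory ProbabilityTheory Filter Topology
open scoped ENNReal

namespace LocScaleMixture

/-- Parameter vectors `(α₁, μ₁, σ₁, …, α_M, μ_M, σ_M) ∈ ℝ^{3M}` with the Euclidean distance. -/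
abbrev Param (M : ℕ) : Type := EuclideanSpace ℝ (Fin M × Fin 3)

/-- The mixing weight `α_m`. -/
def weight {M : ℕ} (θ : Param M) (m : Fin M) : ℝ := θ (m, 0)

/-- The location parameter `μ_m`. -/
def loc {M : ℕ} (θ : Param M) (m : Fin M) : ℝ := θ (m, 1)

/-- The scale parameter `σ_m`. -/
def scale {M : ℕ} (θ : Param M) (m : Fin M) : ℝ := θ (m, 2)

/-- The parameter space `Θ`. -/
def paramSpace (M : ℕ) : Set (Param M) :=
  {θ | (∑ m, weight θ m = 1) ∧ (∀ m, 0 ≤ weight θ m) ∧ ∀ m, 0 < scale θ m}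

/-- A probability density on `ℝ` with respect to Lebesgue measure. -/
structure IsDensity (g : ℝ → ℝ) : Prop where
  nonneg : ∀ x, 0 ≤ g x
  integrable : Integrable g
  integral_eq_one : ∫ x, g x = 1

/-- The location-scale density `f(x; μ, σ) = σ⁻¹ f((x - μ) / σ; 0, 1)`. -/
noncomputable def locScale (g : ℝ → ℝ) (μ σ x : ℝ) : ℝ := (1 / σ) * g ((x - μ) / σ)

/-- `f_𝒦(x; θ) = ∑_{k ∈ 𝒦} α_k f_k(x; μ_k, σ_k)`, where `f m` is the standard density
`f_m(·; 0, 1)`. -/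
noncomputable def subMixture {M : ℕ} (f : Fin M → ℝ → ℝ) (K : Finset (Fin M))
    (θ : Param M) (x : ℝ) : ℝ :=
  ∑ k ∈ K, weight θ k * locScale (f k) (loc θ k) (scale θ k) x

/-- The mixture density `f(x; θ)` with all `M` components. -/
noncomputable def mixture {M : ℕ} (f : Fin M → ℝ → ℝ) (θ : Param M) (x : ℝ) : ℝ :=
  subMixture f Finset.univ θ x

/-- `𝒢_K`: the subprobability densities with at most `K` components. As usual for densities,
functions that agree Lebesgue almost everywhere are identified. -/
def mixtureClass {M : ℕ} (f : Fin M → ℝ → ℝ) (K : ℕ) : Set (ℝ → ℝ) :=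
  {g | ∃ S : Finset (Fin M), S.card ≤ K ∧ ∃ θ ∈ paramSpace M, g =ᵐ[volume] subMixture f S θ}

/-- `Θ(θ)`: the parameters in `Θ` that give the same density as `θ`
(up to Lebesgue null sets, i.e. the same distribution). -/
def equivParams {M : ℕ} (f : Fin M → ℝ → ℝ) (θ : Param M) : Set (Param M) :=
  {θ' | θ' ∈ paramSpace M ∧ mixture f θ' =ᵐ[volume] mixture f θ}

/-- `dist(U, V) = inf_{θ ∈ U} inf_{θ' ∈ V} dist(θ, θ')`, with value `∞` if a set is empty. -/
noncomputable def setDist {M : ℕ} (U V : Set (Param M)) : ℝ≥0∞ :=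
  ⨅ θ ∈ U, ⨅ θ' ∈ V, edist θ θ'

/-- Boundedness and tail condition: `f_m(x; 0, 1) ≤ min {v₀, v₁ |x|^{-β}}` for some `v₀, v₁ > 0`
and `β > 1`. At `x = 0` the second bound is `+∞`, hence void. -/
def TailBound {M : ℕ} (f : Fin M → ℝ → ℝ) : Prop :=
  ∃ v₀ v₁ β : ℝ, 0 < v₀ ∧ 0 < v₁ ∧ 1 < β ∧
    ∀ m x, f m x ≤ v₀ ∧ (x ≠ 0 → f m x ≤ v₁ * |x| ^ (-β))

/-- `f(x; θ, ρ) = sup {f(x; θ') : θ' ∈ Θ, dist(θ', θ) ≤ ρ}`. Under `TailBound` the supremum is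
finite as soon as `ρ < min_m σ_m`, so only for such `ρ` is the value used. -/
noncomputable def ballSup {M : ℕ} (f : Fin M → ℝ → ℝ) (θ : Param M) (ρ x : ℝ) : ℝ :=
  ⨆ θ' : {θ' : Param M // θ' ∈ paramSpace M ∧ dist θ' θ ≤ ρ}, mixture f θ'.1 x

/-- For each `θ` and all sufficiently small `ρ > 0`, `f(·; θ, ρ)` is (Lebesgue) measurable. -/
def SupMeasurable {M : ℕ} (f : Fin M → ℝ → ℝ) : Prop :=
  ∀ θ ∈ paramSpace M, ∀ᶠ ρ in 𝓝[>] (0 : ℝ), AEMeasurable (ballSup f θ ρ) volume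

/-- Continuity in the parameter on compact sets, outside a null set of `x` that may depend on the
limit `θ` but not on the sequence that converges to it. -/
def ParamContinuous {M : ℕ} (f : Fin M → ℝ → ℝ) : Prop :=
  ∀ Γ : Set (Param M), IsCompact Γ → Γ ⊆ paramSpace M → ∀ θ ∈ Γ,
    ∃ N : Set ℝ, volume N = 0 ∧
      ∀ u : ℕ → Param M, (∀ j, u j ∈ Γ) → Tendsto u atTop (𝓝 θ) →
        ∀ x, x ∉ N → Tendsto (fun j => mixture f (u j) x) atTop (𝓝 (mixture f θ x))

/-- `∫ |log f(x; θ₀)| f(x; θ₀) dx < ∞`. -/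
def LogIntegrable {M : ℕ} (f : Fin M → ℝ → ℝ) (θ₀ : Param M) : Prop :=
  Integrable (fun x => |Real.log (mixture f θ₀ x)| * mixture f θ₀ x) volume

/-- The distribution on `ℝ` with density `f(·; θ)`. -/
noncomputable def mixtureLaw {M : ℕ} (f : Fin M → ℝ → ℝ) (θ : Param M) : Measure ℝ :=
  volume.withDensity (fun x => ENNReal.ofReal (mixture f θ x))

/-- `Θ_n = {θ ∈ Θ : σ_m ≥ c_n for all m}` with `c_n = c₀ exp(-n^d)`. -/
def restrictedSpace (M : ℕ) (c₀ d : ℝ) (n : ℕ) : Set (Param M) :=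
  {θ | θ ∈ paramSpace M ∧ ∀ m, c₀ * Real.exp (-((n : ℝ) ^ d)) ≤ scale θ m}

/-- The likelihood of `θ` given the first `n` terms of the sequence of observations `x`. -/
noncomputable def likelihood {M : ℕ} (f : Fin M → ℝ → ℝ) (x : ℕ → ℝ) (n : ℕ) (θ : Param M) : ℝ :=
  ∏ i ∈ Finset.range n, mixture f θ (x i)

/-- `θ` maximizes the likelihood of the first `n` observations over the set `S`. -/
def IsMLE {M : ℕ} (f : Fin M → ℝ → ℝ) (S : Set (Param M)) (x : ℕ → ℝ) (n : ℕ) (θ : Param M) :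
    Prop :=
  θ ∈ S ∧ ∀ θ' ∈ S, likelihood f x n θ' ≤ likelihood f x n θ

end LocScaleMixture

namespace LocScaleMixture

variable {M : ℕ} {f : Fin M → ℝ → ℝ} {θ θ₀ : Param M}

/-! ### Location-scale densities and their mixtures -/

/-! The proof is Wald's argument on a compactification of the parameter space. By compactness, any
subsequence of the estimators has a further one along which each coordinate converges in the
extended reals. Let `S` be the set of components whose scale tends to `0` or `∞` or whose location
tends to `±∞`. If `S` is empty and the limit has density `f₀`, the limit lies in `Θ₀` and the
distance tends to zero.

In every other case the likelihood falls below that of `θ₀`. A component of scale `σ` is at most `η`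
outside an interval of radius `tailRadius`, a multiple of `σ ^ ((β - 1) / β)`, and at most `v₀ / σ`
inside. Up to a small constant, it thus adds to the mean log-likelihood at most the fraction of
observations in the interval times `log (1 + a / σ)`. This vanishes if `σ → ∞` (the logarithm does),
or if `|μ| → ∞` with `σ` tending to a positive limit (the fraction does). If `σ → 0`, the fraction
is `O(ℓ + log n / n)` for radius `ℓ`, uniformly in the centre (`ae_eventually_hits_le`), while `σ ≥
c_n` makes the logarithm `O(n ^ d)` with `d < 1`.

To stay among probability densities, the components in `S` are not deleted but reset to location `0`
and a fixed scale `N` (`resetOn`). As `f₀` needs all `M` components, some `N` makes the limit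
density differ from `f₀` (`exists_resetOn_ne`). Near such a parameter the supremum of the densities
has a smaller expected logarithm (`exists_ballSup_integral_log_lt`), and the law of large numbers
contradicts maximality (`false_of_likelihood_le`). -/

lemma locScale_nonneg {g : ℝ → ℝ} (hg : IsDensity g) {μ σ : ℝ} (hσ : 0 < σ) (x : ℝ) :
    0 ≤ locScale g μ σ x :=
  mul_nonneg (by positivity) (hg.nonneg _)

lemma integrable_locScale {g : ℝ → ℝ} (hg : IsDensity g) {μ σ : ℝ} (hσ : 0 < σ) :
    Integrable (locScale g μ σ) :=
  ((hg.integrable.comp_div hσ.ne').comp_sub_right μ).const_mul (1 / σ)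

lemma integral_locScale {g : ℝ → ℝ} (hg : IsDensity g) {μ σ : ℝ} (hσ : 0 < σ) :
    ∫ x, locScale g μ σ x = 1 := by
  unfold locScale
  rw [integral_const_mul, integral_sub_right_eq_self (fun x => g (x / σ)) μ,
    Measure.integral_comp_div, hg.integral_eq_one, abs_of_pos hσ, smul_eq_mul, mul_one,
    one_div_mul_cancel hσ.ne']

lemma locScale_le {g : ℝ → ℝ} {v μ σ : ℝ} (hσ : 0 < σ) (hg : ∀ x, g x ≤ v) (x : ℝ) :
    locScale g μ σ x ≤ v / σ := by
  rw [locScale, div_mul_eq_mul_div, one_mul]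
  exact div_le_div_of_nonneg_right (hg _) hσ.le

lemma integrable_mixture (hf : ∀ m, IsDensity (f m)) (hθ : θ ∈ paramSpace M) :
    Integrable (mixture f θ) := by
  unfold mixture subMixture
  exact integrable_finsetSum _ fun m _ => (integrable_locScale (hf m) (hθ.2.2 m)).const_mul _

lemma integral_mixture (hf : ∀ m, IsDensity (f m)) (hθ : θ ∈ paramSpace M) :
    ∫ x, mixture f θ x = 1 := by
  unfold mixture subMixture
  rw [integral_finsetSum _ fun m _ => (integrable_locScale (hf m) (hθ.2.2 m)).const_mul _]
  simp_rw [integral_const_mul, integral_locScale (hf _) (hθ.2.2 _), mul_one]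
  exact hθ.1

lemma mixture_nonneg (hf : ∀ m, IsDensity (f m)) (hθ : θ ∈ paramSpace M) (x : ℝ) :
    0 ≤ mixture f θ x := by
  unfold mixture subMixture
  exact Finset.sum_nonneg fun m _ => mul_nonneg (hθ.2.1 m) (locScale_nonneg (hf m) (hθ.2.2 m) x)

lemma weight_le_one (hθ : θ ∈ paramSpace M) (m : Fin M) : weight θ m ≤ 1 := by
  rw [← hθ.1]
  exact Finset.single_le_sum (fun i _ => hθ.2.1 i) (Finset.mem_univ m)

lemma mixture_le {v s : ℝ} (hv : ∀ m x, f m x ≤ v) (hv0 : 0 ≤ v) (hs : 0 < s)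
    (hθ : θ ∈ paramSpace M) (hθs : ∀ m, s ≤ scale θ m) (x : ℝ) : mixture f θ x ≤ v / s := by
  calc mixture f θ x ≤ ∑ m, weight θ m * (v / s) := by
        unfold mixture subMixture
        refine Finset.sum_le_sum fun m _ => mul_le_mul_of_nonneg_left ?_ (hθ.2.1 m)
        exact (locScale_le (hθ.2.2 m) (hv m) x).trans
          (div_le_div_of_nonneg_left hv0 hs (hθs m))
    _ = v / s := by rw [← Finset.sum_mul, hθ.1, one_mul]

lemma exists_scale_lower_bound (hθ : θ ∈ paramSpace M) : ∃ s > 0, ∀ m, s ≤ scale θ m := by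
  rcases isEmpty_or_nonempty (Fin M) with h | h
  · exact ⟨1, one_pos, fun m => h.elim m⟩
  · obtain ⟨m, hm⟩ := Finite.exists_min (scale θ)
    exact ⟨scale θ m, hθ.2.2 m, hm⟩

/-! ### The law of the observations -/

lemma isProbabilityMeasure_mixtureLaw (hf : ∀ m, IsDensity (f m)) (hθ : θ ∈ paramSpace M) :
    IsProbabilityMeasure (mixtureLaw f θ) := by
  refine ⟨?_⟩
  rw [mixtureLaw, withDensity_apply _ MeasurableSet.univ, setLIntegral_univ,
    ← ofReal_integral_eq_lintegral_ofReal (integrable_mixture hf hθ)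
      (.of_forall (mixture_nonneg hf hθ)), integral_mixture hf hθ, ENNReal.ofReal_one]

lemma mixtureLaw_absolutelyContinuous : mixtureLaw f θ ≪ volume :=
  withDensity_absolutelyContinuous _ _

lemma aemeasurable_mixture (hf : ∀ m, IsDensity (f m)) (hθ : θ ∈ paramSpace M) :
    AEMeasurable (mixture f θ) volume :=
  (integrable_mixture hf hθ).aestronglyMeasurable.aemeasurable

lemma ae_mixtureLaw_iff (hf : ∀ m, IsDensity (f m)) (hθ : θ ∈ paramSpace M) {p : ℝ → Prop} :
    (∀ᵐ x ∂(mixtureLaw f θ), p x) ↔ ∀ᵐ x, 0 < mixture f θ x → p x := by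
  rw [mixtureLaw, ae_withDensity_iff' (aemeasurable_mixture hf hθ).ennreal_ofReal]
  simp

lemma mixture_pos_ae (hf : ∀ m, IsDensity (f m)) (hθ : θ ∈ paramSpace M) :
    ∀ᵐ x ∂(mixtureLaw f θ), 0 < mixture f θ x :=
  (ae_mixtureLaw_iff hf hθ).2 (.of_forall fun _ h => h)

lemma integrable_log_mixture (hf : ∀ m, IsDensity (f m)) (hθ : θ ∈ paramSpace M)
    (h : LogIntegrable f θ) :
    Integrable (fun x => Real.log (mixture f θ x)) (mixtureLaw f θ) := by
  have hm := aemeasurable_mixture hf hθ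
  rw [mixtureLaw, integrable_withDensity_iff_integrable_smul₀' hm.ennreal_ofReal
    (.of_forall fun _ => ENNReal.ofReal_lt_top)]
  refine (integrable_norm_iff ?_).1 (h.congr (.of_forall fun x => ?_))
  · exact (hm.ennreal_ofReal.ennreal_toReal.mul
      (Real.measurable_log.comp_aemeasurable hm)).aestronglyMeasurable
  · simp [ENNReal.toReal_ofReal (mixture_nonneg hf hθ x), abs_of_nonneg (mixture_nonneg hf hθ x),
      mul_comm]

lemma mixtureLaw_le {v : ℝ} (hv : ∀ x, mixture f θ x ≤ v) {s : Set ℝ} (hs : MeasurableSet s) :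
    mixtureLaw f θ s ≤ ENNReal.ofReal v * volume s := by
  rw [mixtureLaw, withDensity_apply _ hs, ← setLIntegral_const]
  exact lintegral_mono fun x => ENNReal.ofReal_le_ofReal (hv x)

/-! ### Suprema over small balls -/

lemma abs_coord_sub_le (θ θ' : Param M) (i : Fin M × Fin 3) : |θ' i - θ i| ≤ dist θ' θ := by
  rw [dist_eq_norm, ← Real.norm_eq_abs]
  exact PiLp.norm_apply_le (θ' - θ) i

lemma half_le_scale {s : ℝ} (hθs : ∀ m, s ≤ scale θ m) {θ' : Param M} (h : dist θ' θ ≤ s / 2)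
    (m : Fin M) : s / 2 ≤ scale θ' m := by
  have := (abs_le.1 ((abs_coord_sub_le θ θ' (m, 2)).trans h)).1
  have := hθs m
  unfold scale at *
  linarith

/-- On this ball the scales stay at least `s / 2`, so the open condition of positive scales is
automatic and only closed conditions remain. -/
lemma isCompact_closedBall_inter_paramSpace {s : ℝ} (hs : 0 < s) (hθs : ∀ m, s ≤ scale θ m) :
    IsCompact (Metric.closedBall θ (s / 2) ∩ paramSpace M) := by
  have : Metric.closedBall θ (s / 2) ∩ paramSpace M = Metric.closedBall θ (s / 2) ∩
      {θ' | (∑ m, weight θ' m = 1) ∧ ∀ m, 0 ≤ weight θ' m} := by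
    ext θ'
    refine and_congr_right fun h => ⟨fun h' => ⟨h'.1, h'.2.1⟩, fun h' => ⟨h'.1, h'.2, fun m => ?_⟩⟩
    exact (half_pos hs).trans_le (half_le_scale hθs h m)
  rw [this]
  refine (isCompact_closedBall _ _).inter_right (IsClosed.and ?_ ?_)
  · exact isClosed_eq (by unfold weight; fun_prop) continuous_const
  · simp only [Set.ofPred_forall]
    exact isClosed_iInter fun m => isClosed_le continuous_const (by unfold weight; fun_prop)

lemma bddAbove_ballSup {v s ρ : ℝ} (hv : ∀ m x, f m x ≤ v) (hv0 : 0 ≤ v) (hs : 0 < s)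
    (hθs : ∀ m, s ≤ scale θ m) (hρ : ρ ≤ s / 2) (x : ℝ) :
    BddAbove (Set.range fun θ' : {θ' : Param M // θ' ∈ paramSpace M ∧ dist θ' θ ≤ ρ} =>
      mixture f θ'.1 x) := by
  refine ⟨v / (s / 2), ?_⟩
  rintro _ ⟨θ', rfl⟩
  exact mixture_le hv hv0 (half_pos hs) θ'.2.1 (half_le_scale hθs (θ'.2.2.trans hρ)) x

lemma ballSup_le {v s ρ : ℝ} (hv : ∀ m x, f m x ≤ v) (hv0 : 0 ≤ v) (hs : 0 < s)
    (hθs : ∀ m, s ≤ scale θ m) (hρ : ρ ≤ s / 2) (x : ℝ) :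
    ballSup f θ ρ x ≤ v / (s / 2) :=
  Real.iSup_le (fun θ' => mixture_le hv hv0 (half_pos hs) θ'.2.1
    (half_le_scale hθs (θ'.2.2.trans hρ)) x) (by positivity)

/-- At a fixed `x`, near-maximizers over the shrinking balls converge to `θ`. They depend on `x`,
which is harmless because the null set in `ParamContinuous` does not depend on the sequence. -/
lemma tendsto_ballSup {v s : ℝ} (hv : ∀ m x, f m x ≤ v) (hv0 : 0 ≤ v) (hs : 0 < s)
    (hθ : θ ∈ paramSpace M) (hθs : ∀ m, s ≤ scale θ m) (h3 : ParamContinuous f)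
    {ρ : ℕ → ℝ} (hρ0 : ∀ k, 0 ≤ ρ k) (hρs : ∀ k, ρ k ≤ s / 2) (hρ : Tendsto ρ atTop (𝓝 0)) :
    ∀ᵐ x, Tendsto (fun k => ballSup f θ (ρ k) x) atTop (𝓝 (mixture f θ x)) := by
  obtain ⟨N, hN, H⟩ := h3 _ (isCompact_closedBall_inter_paramSpace hs hθs) Set.inter_subset_right θ
    ⟨Metric.mem_closedBall_self (half_pos hs).le, hθ⟩
  refine (measure_eq_zero_iff_ae_notMem.1 hN).mono fun x hx => ?_
  have key : ∀ k : ℕ, ∃ θ' : Param M, (θ' ∈ paramSpace M ∧ dist θ' θ ≤ ρ k) ∧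
      ballSup f θ (ρ k) x - 1 / ((k : ℝ) + 1) < mixture f θ' x := by
    intro k
    have : Nonempty {θ' : Param M // θ' ∈ paramSpace M ∧ dist θ' θ ≤ ρ k} :=
      ⟨⟨θ, hθ, by simpa using hρ0 k⟩⟩
    obtain ⟨θ', h⟩ := exists_lt_of_lt_ciSup (show ballSup f θ (ρ k) x - 1 / ((k : ℝ) + 1) <
      ballSup f θ (ρ k) x from sub_lt_self _ (by positivity))
    exact ⟨θ'.1, θ'.2, h⟩
  choose u hu hux using key
  have hlim : Tendsto u atTop (𝓝 θ) := tendsto_iff_dist_tendsto_zero.2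
    (squeeze_zero (fun _ => dist_nonneg) (fun k => (hu k).2) hρ)
  have h := H u (fun k => ⟨(hu k).2.trans (hρs k), (hu k).1⟩) hlim x hx
  refine tendsto_of_tendsto_of_tendsto_of_le_of_le tendsto_const_nhds
    (by simpa using h.add (tendsto_one_div_add_atTop_nhds_zero_nat (𝕜 := ℝ))) (fun k => ?_)
    (fun k => ?_)
  · exact le_ciSup (bddAbove_ballSup hv hv0 hs hθs (hρs k) x) ⟨θ, hθ, by simpa using hρ0 k⟩
  · have := hux k
    simp only [one_div] at this ⊢
    linarith

end LocScaleMixture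

namespace LocScaleMixture

variable {M : ℕ} {f : Fin M → ℝ → ℝ} {θ θ₀ : Param M}

/-! ### The Kullback–Leibler gap -/

/-- Agreement where the true density is positive gives one density at least the other almost
everywhere, and both integrate to one. -/
lemma ae_eq_of_ae_mixtureLaw (hf : ∀ m, IsDensity (f m)) (hθ : θ ∈ paramSpace M)
    (hθ₀ : θ₀ ∈ paramSpace M) (h : ∀ᵐ x ∂(mixtureLaw f θ₀), mixture f θ x = mixture f θ₀ x) :
    mixture f θ =ᵐ[volume] mixture f θ₀ := by
  rw [ae_mixtureLaw_iff hf hθ₀] at h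
  have hle : mixture f θ₀ ≤ᵐ[volume] mixture f θ := by
    filter_upwards [h] with x hx
    rcases (mixture_nonneg hf hθ₀ x).eq_or_lt with h0 | h0
    · rw [← h0]; exact mixture_nonneg hf hθ x
    · exact (hx h0).ge
  exact ((integral_eq_iff_of_ae_le (integrable_mixture hf hθ₀) (integrable_mixture hf hθ) hle).1
    (by rw [integral_mixture hf hθ, integral_mixture hf hθ₀])).symm

/-- Averaging with the true density keeps the ratio at least `1 / 2`, so its logarithm is integrable
even if `mixture f θ` vanishes on a set of positive measure. Mass of `mixture f θ` where the true
density is zero is lost, hence only `≤ 1`. -/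
lemma integrable_mixture_ratio (hf : ∀ m, IsDensity (f m)) (hθ : θ ∈ paramSpace M)
    (hθ₀ : θ₀ ∈ paramSpace M) :
    Integrable (fun x => (mixture f θ x + mixture f θ₀ x) / (2 * mixture f θ₀ x))
      (mixtureLaw f θ₀) ∧
    ∫ x, (mixture f θ x + mixture f θ₀ x) / (2 * mixture f θ₀ x) ∂(mixtureLaw f θ₀) ≤ 1 := by
  have hm := aemeasurable_mixture hf hθ
  have hm₀ := aemeasurable_mixture hf hθ₀
  have hg : Integrable (fun x => (mixture f θ x + mixture f θ₀ x) / 2) :=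
    ((integrable_mixture hf hθ).add (integrable_mixture hf hθ₀)).div_const 2
  have hle : ∀ x, (ENNReal.ofReal (mixture f θ₀ x)).toReal •
      ((mixture f θ x + mixture f θ₀ x) / (2 * mixture f θ₀ x)) ≤
      (mixture f θ x + mixture f θ₀ x) / 2 := fun x => by
    have h := mixture_nonneg hf hθ x
    have h₀ := mixture_nonneg hf hθ₀ x
    rw [ENNReal.toReal_ofReal h₀, smul_eq_mul]
    rcases h₀.eq_or_lt with h0 | h0
    · rw [← h0]; simp; linarith
    · apply le_of_eq; field_simp
  have hnn : ∀ x, 0 ≤ (ENNReal.ofReal (mixture f θ₀ x)).toReal •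
      ((mixture f θ x + mixture f θ₀ x) / (2 * mixture f θ₀ x)) := fun x => by
    have h := mixture_nonneg hf hθ x
    have h₀ := mixture_nonneg hf hθ₀ x
    rw [smul_eq_mul]
    positivity
  have hint : Integrable (fun x => (ENNReal.ofReal (mixture f θ₀ x)).toReal •
      ((mixture f θ x + mixture f θ₀ x) / (2 * mixture f θ₀ x))) := by
    refine hg.mono' ?_ (.of_forall fun x => ?_)
    · exact (hm₀.ennreal_ofReal.ennreal_toReal.mul
        ((hm.add hm₀).div (hm₀.const_mul 2))).aestronglyMeasurable
    · rw [Real.norm_of_nonneg (hnn x)]; exact hle x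
  constructor
  · rw [mixtureLaw, integrable_withDensity_iff_integrable_smul₀' hm₀.ennreal_ofReal
      (.of_forall fun _ => ENNReal.ofReal_lt_top)]
    exact hint
  · rw [mixtureLaw, integral_withDensity_eq_integral_toReal_smul₀ hm₀.ennreal_ofReal
      (.of_forall fun _ => ENNReal.ofReal_lt_top)]
    refine (integral_mono hint hg hle).trans_eq ?_
    rw [integral_div, integral_add (integrable_mixture hf hθ) (integrable_mixture hf hθ₀),
      integral_mixture hf hθ, integral_mixture hf hθ₀]
    norm_num

/-- Integrate `log t ≤ t - 1`. Equality of the integrals would force `t = 1` almost everywhere, that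
is, equal densities. -/
lemma integral_log_mixture_ratio_neg (hf : ∀ m, IsDensity (f m)) (hθ : θ ∈ paramSpace M)
    (hθ₀ : θ₀ ∈ paramSpace M) (hne : ¬ mixture f θ =ᵐ[volume] mixture f θ₀) :
    ∫ x, Real.log ((mixture f θ x + mixture f θ₀ x) / (2 * mixture f θ₀ x)) ∂(mixtureLaw f θ₀)
      < 0 := by
  have := isProbabilityMeasure_mixtureLaw hf hθ₀
  obtain ⟨hi, hi1⟩ := integrable_mixture_ratio hf hθ hθ₀
  set t : ℝ → ℝ := fun x => (mixture f θ x + mixture f θ₀ x) / (2 * mixture f θ₀ x) with ht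
  have hhalf : ∀ᵐ x ∂(mixtureLaw f θ₀), 1 / 2 ≤ t x := by
    filter_upwards [mixture_pos_ae hf hθ₀] with x hx
    rw [ht]
    simp only
    rw [div_le_div_iff₀ two_pos (by positivity)]
    linarith [mixture_nonneg hf hθ x]
  have hlog : Integrable (fun x => Real.log (t x)) (mixtureLaw f θ₀) := by
    refine (hi.add (integrable_const (Real.log 2))).mono'
      (Real.measurable_log.comp_aemeasurable hi.aemeasurable).aestronglyMeasurable ?_
    filter_upwards [hhalf] with x hx
    have h1 : Real.log (1 / 2) ≤ Real.log (t x) := Real.log_le_log (by norm_num) hx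
    rw [one_div, Real.log_inv] at h1
    have h2 := Real.log_le_sub_one_of_pos (show 0 < t x by linarith)
    have h3 := Real.log_pos (one_lt_two)
    rw [Real.norm_eq_abs, Pi.add_apply, abs_le]
    constructor <;> linarith
  by_contra! hcon
  refine hne (ae_eq_of_ae_mixtureLaw hf hθ hθ₀ ?_)
  have hi' : Integrable (fun x => t x - 1) (mixtureLaw f θ₀) := hi.sub (integrable_const 1)
  have hd : Integrable (fun x => t x - 1 - Real.log (t x)) (mixtureLaw f θ₀) := hi'.sub hlog
  have hd0 : 0 ≤ᵐ[mixtureLaw f θ₀] fun x => t x - 1 - Real.log (t x) := by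
    filter_upwards [hhalf] with x hx
    have h2 := Real.log_le_sub_one_of_pos (show 0 < t x by linarith)
    simp only [Pi.zero_apply]
    linarith
  have hzero : ∫ x, (t x - 1 - Real.log (t x)) ∂(mixtureLaw f θ₀) = 0 := by
    refine le_antisymm ?_ (integral_nonneg_of_ae hd0)
    rw [integral_sub hi' hlog, integral_sub hi (integrable_const 1)]
    simp only [integral_const, probReal_univ, smul_eq_mul, mul_one]
    linarith
  filter_upwards [(integral_eq_zero_iff_of_nonneg_ae hd0 hd).1 hzero, hhalf,
    mixture_pos_ae hf hθ₀] with x hx hx2 hx0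
  have h1 : t x = 1 := by
    by_contra h
    have := Real.log_lt_sub_one_of_pos (show 0 < t x by linarith) h
    simp only [Pi.zero_apply] at hx
    linarith
  rw [ht] at h1
  simp only at h1
  rw [div_eq_one_iff_eq (by positivity)] at h1
  linarith

lemma ballSup_nonneg (hf : ∀ m, IsDensity (f m)) (ρ x : ℝ) : 0 ≤ ballSup f θ ρ x :=
  Real.iSup_nonneg fun θ' => mixture_nonneg hf θ'.2.1 x

lemma integrable_log_add {ν : Measure ℝ} [IsFiniteMeasure ν] {h : ℝ → ℝ} {C τ : ℝ}
    (hm : AEMeasurable h ν) (h0 : ∀ x, 0 ≤ h x) (hC : ∀ x, h x ≤ C) (hτ : 0 < τ) :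
    Integrable (fun x => Real.log (h x + τ)) ν := by
  refine Integrable.of_mem_Icc (Real.log τ) (Real.log (C + τ))
    (Real.measurable_log.comp_aemeasurable (hm.add_const τ)) (.of_forall fun x => ⟨?_, ?_⟩)
  · exact Real.log_le_log hτ (by linarith [h0 x])
  · exact Real.log_le_log (by linarith [h0 x]) (by linarith [hC x])

/-- Around a parameter whose density differs from the true one, the supremum of the densities over
a small ball, increased by a small constant, still has a strictly smaller expected logarithm than
the true density. -/
theorem exists_ballSup_integral_log_lt (hf : ∀ m, IsDensity (f m)) (hθ₀ : θ₀ ∈ paramSpace M)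
    (h1 : TailBound f) (h2 : SupMeasurable f) (h3 : ParamContinuous f) (h4 : LogIntegrable f θ₀)
    (hθ : θ ∈ paramSpace M) (hne : ¬ mixture f θ =ᵐ[volume] mixture f θ₀) :
    ∃ ρ τ : ℝ, 0 < ρ ∧ 0 < τ ∧ AEMeasurable (ballSup f θ ρ) volume ∧
      (∀ x, ∀ θ' ∈ paramSpace M, dist θ' θ ≤ ρ → mixture f θ' x ≤ ballSup f θ ρ x) ∧
      Integrable (fun x => Real.log (ballSup f θ ρ x + τ)) (mixtureLaw f θ₀) ∧
      ∫ x, Real.log (ballSup f θ ρ x + τ) ∂(mixtureLaw f θ₀) <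
        ∫ x, Real.log (mixture f θ₀ x) ∂(mixtureLaw f θ₀) := by
  have := isProbabilityMeasure_mixtureLaw hf hθ₀
  obtain ⟨v₀, _, _, hv₀, _, _, hv⟩ := h1
  replace hv : ∀ m x, f m x ≤ v₀ := fun m x => (hv m x).1
  obtain ⟨s, hs, hθs⟩ := exists_scale_lower_bound hθ
  obtain ⟨s₀, hs₀, hθs₀⟩ := exists_scale_lower_bound hθ₀
  have hB : ∀ x, mixture f θ₀ x ≤ v₀ / s₀ := mixture_le hv hv₀.le hs₀ hθ₀ hθs₀
  obtain ⟨r, hr, hrm⟩ := (mem_nhdsGT_iff_exists_Ioo_subset).1 (h2 θ hθ)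
  replace hr : 0 < r := hr
  -- The same null sequence shrinks the radii and serves as the offset `τ`, which keeps the
  -- logarithm bounded below.
  set e : ℕ → ℝ := fun k => 1 / ((k : ℝ) + 1)
  have he0 : ∀ k, 0 < e k := fun k => by positivity
  have he1 : ∀ k, e k ≤ 1 := fun k => by
    simp only [e]
    rw [div_le_one (by positivity)]
    linarith [k.cast_nonneg (α := ℝ)]
  have he : Tendsto e atTop (𝓝 0) := tendsto_one_div_add_atTop_nhds_zero_nat
  set q : ℝ := min (r / 2) (s / 2)
  have hq : 0 < q := lt_min (half_pos hr) (half_pos hs)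
  set ρ : ℕ → ℝ := fun k => q * e k
  have hρ0 : ∀ k, 0 < ρ k := fun k => mul_pos hq (he0 k)
  have hρq : ∀ k, ρ k ≤ q := fun k => mul_le_of_le_one_right hq.le (he1 k)
  have hρs : ∀ k, ρ k ≤ s / 2 := fun k => (hρq k).trans (min_le_right _ _)
  have hρ : Tendsto ρ atTop (𝓝 0) := by simpa using he.const_mul q
  have hmeas : ∀ k, AEMeasurable (ballSup f θ (ρ k)) volume := fun k => hrm
    ⟨hρ0 k, ((hρq k).trans (min_le_left _ _)).trans_lt (half_lt_self hr)⟩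
  have hC : ∀ k x, ballSup f θ (ρ k) x ≤ v₀ / (s / 2) := fun k =>
    ballSup_le hv hv₀.le hs hθs (hρs k)
  set C := v₀ / (s / 2)
  have hlim := tendsto_ballSup hv hv₀.le hs hθ hθs h3 (fun k => (hρ0 k).le) hρs hρ
  have hac : mixtureLaw f θ₀ ≪ volume := mixtureLaw_absolutelyContinuous
  have hm₀ := (aemeasurable_mixture hf hθ₀).mono_ac hac
  have hlog₀ := integrable_log_mixture hf hθ₀ h4
  -- Again the averaged ratio: it is at least `1 / 2`, so `F k` has an integrable bound uniform in
  -- `k` and dominated convergence applies.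
  set F : ℕ → ℝ → ℝ := fun k x =>
    Real.log ((ballSup f θ (ρ k) x + e k + mixture f θ₀ x) / (2 * mixture f θ₀ x)) with hF
  have hFm : ∀ k, AEStronglyMeasurable (F k) (mixtureLaw f θ₀) := fun k =>
    (Real.measurable_log.comp_aemeasurable (((((hmeas k).mono_ac hac).add_const _).add hm₀).div
      (hm₀.const_mul 2))).aestronglyMeasurable
  set D := v₀ / s₀
  have hD : 0 < D := by positivity
  have hCpos : 0 < C := by positivity
  have hFb : ∀ k, ∀ᵐ x ∂(mixtureLaw f θ₀), ‖F k x‖ ≤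
      Real.log 2 + Real.log (C + 1 + D) + |Real.log (mixture f θ₀ x)| := fun k => by
    filter_upwards [mixture_pos_ae hf hθ₀] with x hx
    have hb := ballSup_nonneg (θ := θ) hf (ρ k) x
    have hpos : 0 < ballSup f θ (ρ k) x + e k + mixture f θ₀ x := by linarith [he0 k]
    have h3 := Real.log_pos (one_lt_two)
    have h5 : 0 ≤ Real.log (C + 1 + D) := Real.log_nonneg (by linarith)
    have h6 : Real.log (1 / 2) ≤ F k x := Real.log_le_log (by norm_num) (by
      rw [div_le_div_iff₀ two_pos (by positivity)]
      linarith [he0 k])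
    rw [one_div, Real.log_inv] at h6
    have h7 : F k x = Real.log (ballSup f θ (ρ k) x + e k + mixture f θ₀ x) -
        (Real.log 2 + Real.log (mixture f θ₀ x)) := by
      rw [hF]
      simp only
      rw [Real.log_div hpos.ne' (by positivity), Real.log_mul two_ne_zero hx.ne']
    have h8 : Real.log (ballSup f θ (ρ k) x + e k + mixture f θ₀ x) ≤ Real.log (C + 1 + D) :=
      Real.log_le_log hpos (by linarith [hC k x, he1 k, hB x])
    rw [Real.norm_eq_abs, abs_le]
    constructor
    · linarith [abs_nonneg (Real.log (mixture f θ₀ x))]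
    · linarith [neg_abs_le (Real.log (mixture f θ₀ x))]
  have hbound : Integrable (fun x => Real.log 2 + Real.log (C + 1 + D) +
      |Real.log (mixture f θ₀ x)|) (mixtureLaw f θ₀) := (integrable_const _).add hlog₀.abs
  have hDCT : Tendsto (fun k => ∫ x, F k x ∂(mixtureLaw f θ₀)) atTop
      (𝓝 (∫ x, Real.log ((mixture f θ x + mixture f θ₀ x) / (2 * mixture f θ₀ x))
        ∂(mixtureLaw f θ₀))) := by
    refine tendsto_integral_of_dominated_convergence _ hFm hbound hFb ?_
    filter_upwards [mixture_pos_ae hf hθ₀, hac.ae_le hlim] with x hx hxl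
    refine Tendsto.log (Tendsto.div_const ?_ _) ?_
    · simpa using (hxl.add he).add_const (mixture f θ₀ x)
    · have := mixture_nonneg hf hθ x
      positivity
  obtain ⟨k, hk⟩ := (hDCT.eventually_lt_const
    (integral_log_mixture_ratio_neg hf hθ hθ₀ hne)).exists
  have hint := integrable_log_add (ν := mixtureLaw f θ₀) ((hmeas k).mono_ac hac)
    (ballSup_nonneg hf (ρ k)) (hC k) (he0 k)
  refine ⟨ρ k, e k, hρ0 k, he0 k, hmeas k, fun x θ' hθ' hd =>
    le_ciSup (bddAbove_ballSup hv hv₀.le hs hθs (hρs k) x) ⟨θ', hθ', hd⟩, hint, ?_⟩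
  have hFint : Integrable (F k) (mixtureLaw f θ₀) := hbound.mono' (hFm k) (hFb k)
  -- From `4ab ≤ (a + b)²`: the ratio `h / f₀` is at most the square of the averaged ratio, so its
  -- logarithm is at most `2 * F k`.
  have key : ∫ x, (Real.log (ballSup f θ (ρ k) x + e k) - Real.log (mixture f θ₀ x))
      ∂(mixtureLaw f θ₀) ≤ ∫ x, 2 * F k x ∂(mixtureLaw f θ₀) := by
    refine integral_mono_ae (hint.sub hlog₀) (hFint.const_mul 2) ?_
    filter_upwards [mixture_pos_ae hf hθ₀] with x hx
    have hb := ballSup_nonneg (θ := θ) hf (ρ k) x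
    have hh : 0 < ballSup f θ (ρ k) x + e k := by linarith [he0 k]
    simp only [hF]
    rw [← Real.log_div hh.ne' hx.ne', show (2 : ℝ) = ((2 : ℕ) : ℝ) by norm_num, ← Real.log_pow]
    refine Real.log_le_log (by positivity) ?_
    push_cast
    rw [div_pow, div_le_div_iff₀ hx (by positivity)]
    nlinarith [mul_nonneg hx.le (sq_nonneg (ballSup f θ (ρ k) x + e k - mixture f θ₀ x))]
  rw [integral_sub hint hlog₀, integral_const_mul] at key
  linarith

end LocScaleMixture

namespace LocScaleMixture

/-! ### The number of observations in short intervals -/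

open Classical in
/-- The number of the first `n` terms of `x` that lie in `s`. -/
noncomputable def hits (x : ℕ → ℝ) (n : ℕ) (s : Set ℝ) : ℕ :=
  ((Finset.range n).filter fun i => x i ∈ s).card

lemma hits_le (x : ℕ → ℝ) (n : ℕ) (s : Set ℝ) : hits x n s ≤ n := by
  classical
  simpa [hits] using Finset.card_filter_le (Finset.range n) fun i => x i ∈ s

lemma hits_mono (x : ℕ → ℝ) (n : ℕ) {s t : Set ℝ} (h : s ⊆ t) : hits x n s ≤ hits x n t := by
  classical
  exact Finset.card_le_card (Finset.monotone_filter_right _ fun _ _ hi => h hi)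

lemma hits_union_le (x : ℕ → ℝ) (n : ℕ) (s t : Set ℝ) :
    hits x n (s ∪ t) ≤ hits x n s + hits x n t := by
  classical
  unfold hits
  simp only [Set.mem_union, Finset.filter_or]
  exact Finset.card_union_le _ _

lemma sum_indicator_eq_hits (x : ℕ → ℝ) (n : ℕ) (s : Set ℝ) (c : ℝ) :
    ∑ i ∈ Finset.range n, s.indicator (fun _ => c) (x i) = hits x n s * c := by
  classical
  simp only [hits, Set.indicator_apply]
  rw [← Finset.sum_filter, Finset.sum_const, nsmul_eq_mul]

variable {Ω : Type*} [MeasurableSpace Ω] {P : Measure Ω} {X : ℕ → Ω → ℝ} {ν : Measure ℝ}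

/-- Union bound over the `k`-element subsets of indices, with independence for each subset. -/
lemma measure_le_hits (hindep : iIndepFun X P) (hlaw : ∀ i, HasLaw (X i) ν P) (n k : ℕ)
    {s : Set ℝ} (hs : MeasurableSet s) :
    P {ω | k ≤ hits (fun i => X i ω) n s} ≤ n.choose k * ν s ^ k := by
  classical
  have hsub : {ω | k ≤ hits (fun i => X i ω) n s} ⊆
      ⋃ S ∈ (Finset.range n).powersetCard k, ⋂ i ∈ S, X i ⁻¹' s := by
    intro ω hω
    obtain ⟨S, hS, hcard⟩ := Finset.exists_subset_card_eq (Set.mem_ofPred_eq ▸ hω)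
    simp only [Set.mem_iUnion, Set.mem_iInter, Finset.mem_powersetCard]
    exact ⟨S, ⟨hS.trans (Finset.filter_subset _ _), hcard⟩,
      fun i hi => (Finset.mem_filter.1 (hS hi)).2⟩
  refine (measure_mono hsub).trans ((measure_biUnion_finset_le _ _).trans ?_)
  have : ∀ S ∈ (Finset.range n).powersetCard k, P (⋂ i ∈ S, X i ⁻¹' s) = ν s ^ k := by
    intro S hS
    rw [hindep.measure_inter_preimage_eq_mul S (sets := fun _ => s) fun _ _ => hs]
    have hi : ∀ i ∈ S, P (X i ⁻¹' s) = ν s := fun i _ => by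
      rw [← (hlaw i).map_eq, Measure.map_apply_of_aemeasurable (hlaw i).aemeasurable hs]
    rw [Finset.prod_congr rfl hi, Finset.prod_const, (Finset.mem_powersetCard.1 hS).2]
  rw [Finset.sum_congr rfl this, Finset.sum_const, Finset.card_powersetCard, Finset.card_range,
    nsmul_eq_mul]

/-- The cells of the partition of the line into intervals of length `δ`. -/
def cell (δ : ℝ) (i : ℤ) : Set ℝ := {x | ⌊x / δ⌋ = i}

lemma measurableSet_cell (δ : ℝ) (i : ℤ) : MeasurableSet (cell δ i) :=
  (Int.measurable_floor.comp (measurable_id.div_const δ)) (measurableSet_singleton i)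

lemma volume_cell {δ : ℝ} (hδ : 0 < δ) (i : ℤ) : volume (cell δ i) = ENNReal.ofReal δ := by
  have : cell δ i = Set.Ico (i * δ) ((i + 1) * δ) := by
    ext x
    simp [cell, Int.floor_eq_iff, le_div_iff₀ hδ, div_lt_iff₀ hδ]
  rw [this, Real.volume_Ico]
  congr 1
  ring

/-- There are infinitely many cells. One of the `k + 1` factors is kept as `ν (cell δ i)`, whose sum
over the disjoint cells is at most one; the others are bounded by `q`. -/
lemma measure_exists_cell_le [IsProbabilityMeasure ν] (hindep : iIndepFun X P)
    (hlaw : ∀ i, HasLaw (X i) ν P) (n k : ℕ) {δ : ℝ} {q : ℝ≥0∞} (hq : ∀ i, ν (cell δ i) ≤ q) :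
    P {ω | ∃ i, k + 1 ≤ hits (fun i => X i ω) n (cell δ i)} ≤ n.choose (k + 1) * q ^ k := by
  rw [Set.ofPred_exists]
  calc P (⋃ i, {ω | k + 1 ≤ hits (fun i => X i ω) n (cell δ i)})
      ≤ ∑' i, P {ω | k + 1 ≤ hits (fun i => X i ω) n (cell δ i)} := measure_iUnion_le _
    _ ≤ ∑' i, n.choose (k + 1) * q ^ k * ν (cell δ i) := by
        refine ENNReal.tsum_le_tsum fun i => ?_
        refine (measure_le_hits hindep hlaw n (k + 1) (measurableSet_cell δ i)).trans ?_
        rw [pow_succ, mul_assoc]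
        gcongr
        exact hq i
    _ ≤ n.choose (k + 1) * q ^ k := by
        rw [ENNReal.tsum_mul_left]
        refine mul_le_of_le_one_right' ?_
        rw [← measure_univ (μ := ν)]
        refine tsum_measure_le_measure_univ
          (fun i => (measurableSet_cell δ i).nullMeasurableSet) fun i j hij => ?_
        refine Disjoint.aedisjoint (Set.disjoint_left.2 fun x hi hj => hij ?_)
        exact hi.symm.trans hj

/-- Bound the binomial by `n ^ (k + 1) / k!`. From `(8vj) ^ k / k! ≤ exp (8vj)` and `exp 2 ≤ 8`, the
quantity `(vj) ^ k / k!` is at most `exp (8vj - 2k)`, hence at most `n ^ (-4)`. -/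
lemma choose_mul_pow_le {v : ℝ} (hv : 0 ≤ v) {n j k : ℕ} (hn : 1 ≤ n)
    (hk : 8 * v * j + 4 * Real.log n ≤ k) :
    (n.choose (k + 1) : ℝ) * (v * (j / n)) ^ k ≤ 1 / (n : ℝ) ^ 3 := by
  have hn1 : (1 : ℝ) ≤ n := by exact_mod_cast hn
  have hn0 : (0 : ℝ) < n := by linarith
  have hlog : 0 ≤ Real.log n := Real.log_nonneg hn1
  have hfac : (0 : ℝ) < k.factorial := by exact_mod_cast k.factorial_pos
  have h8 : Real.exp 2 ≤ 8 := by
    rw [show (2 : ℝ) = 1 + 1 by norm_num, Real.exp_add]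
    nlinarith [Real.exp_one_lt_d9, Real.exp_pos 1]
  have hexp : (v * j) ^ k / k.factorial ≤ 1 / (n : ℝ) ^ 4 := by
    have h1 := Real.pow_div_factorial_le_exp (8 * (v * j)) (by positivity) k
    rw [mul_pow, mul_div_assoc] at h1
    have h2 : Real.exp (2 * k) * ((v * j) ^ k / k.factorial) ≤ Real.exp (8 * (v * j)) := by
      refine le_trans ?_ h1
      refine mul_le_mul_of_nonneg_right ?_ (by positivity)
      rw [mul_comm, Real.exp_nat_mul]
      exact pow_le_pow_left₀ (Real.exp_pos 2).le h8 k
    have h3 : Real.exp (8 * (v * j)) ≤ Real.exp (2 * k) * (1 / (n : ℝ) ^ 4) := by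
      have h4 : 1 / (n : ℝ) ^ 4 = Real.exp (-(4 * Real.log n)) := by
        rw [Real.exp_neg, one_div, show (4 : ℝ) = ((4 : ℕ) : ℝ) by norm_num, Real.exp_nat_mul,
          Real.exp_log hn0]
      rw [h4, ← Real.exp_add]
      refine Real.exp_le_exp.2 ?_
      nlinarith [mul_nonneg hv j.cast_nonneg]
    exact le_of_mul_le_mul_left (h2.trans h3) (Real.exp_pos _)
  calc (n.choose (k + 1) : ℝ) * (v * (j / n)) ^ k
      ≤ (n ^ (k + 1) / (k + 1).factorial) * (v * (j / n)) ^ k := by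
        refine mul_le_mul_of_nonneg_right (Nat.choose_le_pow_div _ _) (by positivity)
    _ ≤ (n ^ (k + 1) / k.factorial) * (v * (j / n)) ^ k := by
        gcongr
        exact k.le_succ
    _ = n * ((v * j) ^ k / k.factorial) := by
        rw [← mul_div_assoc v, div_pow]
        field_simp
        ring
    _ ≤ n * (1 / (n : ℝ) ^ 4) := mul_le_mul_of_nonneg_left hexp hn0.le
    _ = 1 / (n : ℝ) ^ 3 := by field_simp

/-- Almost surely, eventually every interval of radius `ℓ ≤ 1/2` contains at most a constant times
`n ℓ + log n + 1` of the first `n` observations. -/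
theorem ae_eventually_hits_le [IsProbabilityMeasure ν] (hindep : iIndepFun X P)
    (hlaw : ∀ i, HasLaw (X i) ν P) {v : ℝ} (hv : 1 ≤ v)
    (hν : ∀ s, MeasurableSet s → ν s ≤ ENNReal.ofReal v * volume s) :
    ∀ᵐ ω ∂P, ∀ᶠ n : ℕ in atTop, ∀ a ℓ : ℝ, 0 < ℓ → ℓ ≤ 1 / 2 →
      (hits (fun i => X i ω) n {x | |x - a| ≤ ℓ} : ℝ) ≤
        32 * v * (n * ℓ + Real.log n + 1) := by
  set K : ℕ → ℕ → ℕ := fun n j => ⌈8 * v * j + 4 * Real.log n⌉₊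
  -- Only the cell widths `j / n` with `1 ≤ j ≤ n` are tested: `n` events of probability at most `n
  -- ^ (-3)`, so Borel–Cantelli applies.
  set E : ℕ → Set Ω := fun n => {ω | ∃ j ∈ Finset.Icc 1 n, ∃ i,
    K n j + 1 ≤ hits (fun i => X i ω) n (cell (j / n) i)}
  have hE : ∀ n, P (E n) ≤ ENNReal.ofReal (1 / (n : ℝ) ^ 2) := by
    intro n
    rcases n.eq_zero_or_pos with rfl | hn
    · simp [E]
    have hn' : (0 : ℝ) < n := by exact_mod_cast hn
    have hEU : E n = ⋃ j ∈ Finset.Icc 1 n,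
        {ω | ∃ i, K n j + 1 ≤ hits (fun i => X i ω) n (cell (j / n) i)} := by
      ext ω
      simp [E]
    rw [hEU]
    refine (measure_biUnion_finset_le _ _).trans ?_
    calc ∑ j ∈ Finset.Icc 1 n, P {ω | ∃ i, K n j + 1 ≤ hits (fun i => X i ω) n (cell (j / n) i)}
        ≤ ∑ j ∈ Finset.Icc 1 n, ENNReal.ofReal (1 / (n : ℝ) ^ 3) := by
          refine Finset.sum_le_sum fun j hj => ?_
          have hj0 : (0 : ℝ) < j := by exact_mod_cast (Finset.mem_Icc.1 hj).1
          have hδ : (0 : ℝ) < j / n := by positivity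
          refine (measure_exists_cell_le hindep hlaw n (K n j)
            (q := ENNReal.ofReal (v * (j / n))) fun i => ?_).trans ?_
          · refine (hν _ (measurableSet_cell _ _)).trans_eq ?_
            rw [volume_cell hδ, ENNReal.ofReal_mul (by linarith)]
          · rw [← ENNReal.ofReal_pow (by positivity), ← ENNReal.ofReal_natCast,
              ← ENNReal.ofReal_mul (by positivity)]
            refine ENNReal.ofReal_le_ofReal (choose_mul_pow_le (by linarith) hn (Nat.le_ceil _))
      _ = ENNReal.ofReal (1 / (n : ℝ) ^ 2) := by
          rw [Finset.sum_const, Nat.card_Icc, nsmul_eq_mul, ← ENNReal.ofReal_natCast,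
            ← ENNReal.ofReal_mul (by positivity)]
          congr 1
          simp
          field_simp
  have hsum : ∑' n, P (E n) ≠ ⊤ := by
    have hs : Summable fun n : ℕ => 1 / (n : ℝ) ^ 2 := Real.summable_one_div_nat_pow.2 one_lt_two
    refine ne_top_of_le_ne_top ?_ (ENNReal.tsum_le_tsum hE)
    exact hs.tsum_ofReal_ne_top
  filter_upwards [ae_eventually_notMem hsum] with ω hω
  filter_upwards [hω, eventually_ge_atTop 1] with n hn hn1 a ℓ hℓ hℓ2
  have hn' : (1 : ℝ) ≤ n := by exact_mod_cast hn1
  simp only [E, Set.mem_ofPred_eq, not_exists, not_and, not_le] at hn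
  -- The least tested width that is at least `2 * ℓ`; `ℓ ≤ 1 / 2` ensures `j ≤ n`. The interval then
  -- meets at most two adjacent cells.
  set j := ⌈2 * ℓ * n⌉₊
  have hj1 : 1 ≤ j := Nat.one_le_iff_ne_zero.2 (Nat.ceil_pos.2 (by positivity)).ne'
  have hjn : j ≤ n := Nat.ceil_le.2 (by nlinarith)
  have hjlt : (j : ℝ) < 2 * ℓ * n + 1 := Nat.ceil_lt_add_one (by positivity)
  have hjge : 2 * ℓ * n ≤ j := Nat.le_ceil _
  have hj0 : (0 : ℝ) < j := by exact_mod_cast hj1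
  have hδ : (0 : ℝ) < j / n := by positivity
  have hδℓ : 2 * ℓ ≤ j / n := (le_div_iff₀ (by linarith)).2 hjge
  have hcells := hn j (Finset.mem_Icc.2 ⟨hj1, hjn⟩)
  set i := ⌊(a - ℓ) / (j / n)⌋
  have hsub : {x | |x - a| ≤ ℓ} ⊆ cell (j / n) i ∪ cell (j / n) (i + 1) := by
    intro x hx
    obtain ⟨h1, h2⟩ := abs_le.1 (Set.mem_ofPred_eq ▸ hx)
    have hlow : i ≤ ⌊x / (j / n)⌋ :=
      Int.floor_mono (div_le_div_of_nonneg_right (by linarith) hδ.le)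
    have hupp : ⌊x / (j / n)⌋ ≤ i + 1 := by
      rw [← Int.floor_add_one]
      refine Int.floor_mono ?_
      rw [div_add_one hδ.ne']
      exact div_le_div_of_nonneg_right (by linarith) hδ.le
    rcases (show ⌊x / (j / n)⌋ = i ∨ ⌊x / (j / n)⌋ = i + 1 by omega) with h | h
    · exact .inl h
    · exact .inr h
  have hnat : hits (fun i => X i ω) n {x | |x - a| ≤ ℓ} ≤ K n j + K n j :=
    ((hits_mono _ n hsub).trans (hits_union_le _ n _ _)).trans
      (add_le_add (Nat.lt_succ_iff.1 (hcells i)) (Nat.lt_succ_iff.1 (hcells (i + 1))))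
  have hlogn : 0 ≤ Real.log n := Real.log_nonneg hn'
  have hK : (K n j : ℝ) < 8 * v * j + 4 * Real.log n + 1 := Nat.ceil_lt_add_one (by positivity)
  calc (hits (fun i => X i ω) n {x | |x - a| ≤ ℓ} : ℝ) ≤ (K n j + K n j : ℕ) := by
        exact_mod_cast hnat
    _ ≤ 2 * (8 * v * (2 * ℓ * n + 1) + 4 * Real.log n + 1) := by
        push_cast
        nlinarith
    _ ≤ 32 * v * (n * ℓ + Real.log n + 1) := by
        nlinarith [mul_nonneg (sub_nonneg.2 hv) hlogn]

/-! ### The law of large numbers -/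

lemma ae_of_hasLaw (hlaw : ∀ i, HasLaw (X i) ν P) {p : ℝ → Prop} (hp : ∀ᵐ x ∂ν, p x) :
    ∀ᵐ ω ∂P, ∀ i, p (X i ω) := by
  refine ae_all_iff.2 fun i => ae_of_ae_map (hlaw i).aemeasurable ?_
  rwa [(hlaw i).map_eq]

/-- `h` is only almost everywhere measurable, so the strong law is applied to a measurable version
of it. -/
theorem ae_tendsto_average (hindep : iIndepFun X P) (hlaw : ∀ i, HasLaw (X i) ν P)
    {h : ℝ → ℝ} (hh : Integrable h ν) :
    ∀ᵐ ω ∂P, Tendsto (fun n : ℕ => (∑ i ∈ Finset.range n, h (X i ω)) / n) atTop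
      (𝓝 (∫ x, h x ∂ν)) := by
  obtain ⟨g, hg, hgh⟩ := hh.aestronglyMeasurable
  have hgm := hg.measurable
  have hident : ∀ i, IdentDistrib (g ∘ X i) (g ∘ X 0) P P := fun i =>
    (IdentDistrib.mk (hlaw i).aemeasurable (hlaw 0).aemeasurable
      (by rw [(hlaw i).map_eq, (hlaw 0).map_eq])).comp hgm
  have hgi : Integrable (g ∘ X 0) P := by
    refine Integrable.comp_aemeasurable ?_ (hlaw 0).aemeasurable
    rw [(hlaw 0).map_eq]
    exact hh.congr hgh
  have hint : ∫ ω, (g ∘ X 0) ω ∂P = ∫ x, h x ∂ν := by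
    rw [(hlaw 0).integral_comp hgm.aestronglyMeasurable]
    exact integral_congr_ae hgh.symm
  have := strong_law_ae_real (fun i => g ∘ X i) hgi
    (fun i j hij => (hindep.indepFun hij).comp hgm hgm) hident
  filter_upwards [this, ae_of_hasLaw hlaw hgh] with ω hω hω'
  rw [hint] at hω
  simpa only [hω', Function.comp_apply] using hω

end LocScaleMixture

namespace LocScaleMixture

variable {M : ℕ} {f : Fin M → ℝ → ℝ} {θ θ₀ : Param M}

/-! ### Degenerating components -/

/-- The distance from its location beyond which a component of scale `σ` with the tail bound
`v |x| ^ (-β)` is at most `η`. -/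
noncomputable def tailRadius (v β η σ : ℝ) : ℝ := (v / η) ^ (1 / β) * σ ^ ((β - 1) / β)

lemma tailRadius_pos {v β η σ : ℝ} (hv : 0 < v) (hη : 0 < η) (hσ : 0 < σ) :
    0 < tailRadius v β η σ := by
  unfold tailRadius
  positivity

lemma tailRadius_rpow {v β η σ : ℝ} (hv : 0 < v) (hη : 0 < η) (hσ : 0 < σ) (hβ : 1 < β) :
    v * tailRadius v β η σ ^ (-β) = η * σ ^ (1 - β) := by
  unfold tailRadius
  have hβ0 : β ≠ 0 := by linarith
  rw [Real.mul_rpow (by positivity) (by positivity), ← Real.rpow_mul (by positivity),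
    ← Real.rpow_mul hσ.le, show 1 / β * -β = -1 by field_simp,
    show (β - 1) / β * -β = 1 - β by
      rw [mul_neg, div_mul_cancel₀ _ hβ0, neg_sub], Real.rpow_neg_one]
  field_simp

/-- Inside the interval the uniform bound applies. The radius `r` solves `v₁ * r ^ (-β) * σ ^ (β -
1) = η`, so outside it the tail bound gives at most `η`. -/
lemma locScale_le_add_indicator {g : ℝ → ℝ} {v₀ v₁ β η μ σ : ℝ} (hv₁ : 0 < v₁) (hβ : 1 < β)
    (hη : 0 < η) (hσ : 0 < σ) (hg0 : ∀ x, 0 ≤ g x) (hg : ∀ x, g x ≤ v₀)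
    (hg' : ∀ x, x ≠ 0 → g x ≤ v₁ * |x| ^ (-β)) (x : ℝ) :
    locScale g μ σ x ≤
      η + {y | |y - μ| ≤ tailRadius v₁ β η σ}.indicator (fun _ => v₀ / σ) x := by
  have hv0 : 0 ≤ v₀ := (hg0 0).trans (hg 0)
  by_cases hx : |x - μ| ≤ tailRadius v₁ β η σ
  · rw [Set.indicator_of_mem (show x ∈ {y | |y - μ| ≤ tailRadius v₁ β η σ} from hx)]
    linarith [locScale_le (μ := μ) hσ hg x]
  · rw [Set.indicator_of_notMem (show x ∉ {y | |y - μ| ≤ tailRadius v₁ β η σ} from hx), add_zero]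
    push Not at hx
    have hr := tailRadius_pos (β := β) hv₁ hη hσ
    have hxμ : 0 < |x - μ| := hr.trans hx
    have h1 : g ((x - μ) / σ) ≤ v₁ * |(x - μ) / σ| ^ (-β) :=
      hg' _ (div_ne_zero (abs_pos.1 hxμ) hσ.ne')
    have h2 : |x - μ| ^ (-β) ≤ tailRadius v₁ β η σ ^ (-β) :=
      Real.rpow_le_rpow_of_nonpos hr hx.le (by linarith)
    have h3 : v₁ * |(x - μ) / σ| ^ (-β) ≤ η * σ := by
      rw [abs_div, abs_of_pos hσ, Real.div_rpow hxμ.le hσ.le, ← mul_div_assoc,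
        div_le_iff₀ (by positivity)]
      calc v₁ * |x - μ| ^ (-β) ≤ v₁ * tailRadius v₁ β η σ ^ (-β) :=
            mul_le_mul_of_nonneg_left h2 hv₁.le
        _ = η * σ ^ (1 - β) := tailRadius_rpow hv₁ hη hσ hβ
        _ = η * σ * σ ^ (-β) := by
            rw [sub_eq_add_neg, Real.rpow_add hσ, Real.rpow_one, mul_assoc]
    rw [locScale, div_mul_eq_mul_div, one_mul, div_le_iff₀ hσ]
    exact h1.trans h3

lemma hits_div_le_one (x : ℕ → ℝ) (n : ℕ) (s : Set ℝ) : (hits x n s : ℝ) / n ≤ 1 :=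
  div_le_one_of_le₀ (by exact_mod_cast hits_le x n s) n.cast_nonneg

lemma log_one_add_div_nonneg {a σ : ℝ} (ha : 0 ≤ a) (hσ : 0 < σ) : 0 ≤ Real.log (1 + a / σ) :=
  Real.log_nonneg (by have : 0 ≤ a / σ := by positivity
                      linarith)

lemma tendsto_hits_mul_log_of_scale_atTop (x : ℕ → ℝ) {ns : ℕ → ℕ} {σ : ℕ → ℝ}
    {s : ℕ → Set ℝ} {a : ℝ} (ha : 0 ≤ a) (hσ0 : ∀ᶠ k in atTop, 0 < σ k)
    (hσ : Tendsto σ atTop atTop) :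
    Tendsto (fun k => (hits x (ns k) (s k) : ℝ) / ns k * Real.log (1 + a / σ k)) atTop (𝓝 0) := by
  have hlog : Tendsto (fun k => Real.log (1 + a / σ k)) atTop (𝓝 0) := by
    have := (tendsto_const_nhds (x := (1 : ℝ))).add (hσ.const_div_atTop a)
    simpa using this.log (by norm_num)
  refine squeeze_zero' ?_ ?_ hlog
  · filter_upwards [hσ0] with k hk
    exact mul_nonneg (by positivity) (log_one_add_div_nonneg ha hk)
  · filter_upwards [hσ0] with k hk
    exact mul_le_of_le_one_left (log_one_add_div_nonneg ha hk) (hits_div_le_one _ _ _)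

/-- The interval has bounded radius and a centre that escapes, so it eventually lies in `{|y| > A}`
for each `A`, where few observations fall. -/
lemma tendsto_hits_mul_log_of_loc_atTop {x : ℕ → ℝ} {p : ℕ → ℝ} (hp : Tendsto p atTop (𝓝 0))
    (hx : ∀ A : ℕ, Tendsto (fun n : ℕ => (hits x n {y | (A : ℝ) < |y|} : ℝ) / n) atTop (𝓝 (p A)))
    {ns : ℕ → ℕ} (hns : Tendsto ns atTop atTop) {μ σ : ℕ → ℝ} {σ₁ : ℝ} {r : ℝ → ℝ}
    (hr : ContinuousAt r σ₁) (hσ₁ : 0 < σ₁) (hσ : Tendsto σ atTop (𝓝 σ₁))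
    (hμ : Tendsto (fun k => |μ k|) atTop atTop) {a : ℝ} (ha : 0 ≤ a) :
    Tendsto (fun k => (hits x (ns k) {y | |y - μ k| ≤ r (σ k)} : ℝ) / ns k *
      Real.log (1 + a / σ k)) atTop (𝓝 0) := by
  have hlog : Tendsto (fun k => Real.log (1 + a / σ k)) atTop (𝓝 (Real.log (1 + a / σ₁))) := by
    refine Tendsto.log (tendsto_const_nhds.add (tendsto_const_nhds.div hσ hσ₁.ne')) ?_
    positivity
  have hfrac : Tendsto (fun k => (hits x (ns k) {y | |y - μ k| ≤ r (σ k)} : ℝ) / ns k) atTop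
      (𝓝 0) := by
    refine tendsto_order.2 ⟨fun e he => .of_forall fun k => he.trans_le (by positivity),
      fun e he => ?_⟩
    obtain ⟨A, hA⟩ := (hp.eventually_lt_const he).exists
    filter_upwards [((hx A).comp hns).eventually_lt_const hA,
      (hr.tendsto.comp hσ).eventually_lt_const (lt_add_one (r σ₁)),
      hμ.eventually_gt_atTop (A + (r σ₁ + 1))] with k h1 h2 h3
    refine lt_of_le_of_lt ?_ h1
    refine div_le_div_of_nonneg_right ?_ (Nat.cast_nonneg _)
    refine Nat.cast_le.2 (hits_mono _ _ fun y hy => ?_)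
    replace hy : |y - μ k| ≤ r (σ k) := hy
    have h4 : |μ k| ≤ |y| + |y - μ k| := by
      rw [abs_sub_comm]
      have := abs_add_le y (μ k - y)
      rwa [add_sub_cancel] at this
    simp only [Function.comp_apply] at h2
    change (A : ℝ) < |y|
    linarith
  simpa using hfrac.mul hlog

lemma tendsto_log_mul_id_div {d c : ℝ} (hd : d < 1) :
    Tendsto (fun n : ℕ => (Real.log n + 1) / n * (c + (n : ℝ) ^ d)) atTop (𝓝 0) := by
  have hlog : ∀ r : ℝ, 0 < r → Tendsto (fun t : ℝ => Real.log t / t ^ r) atTop (𝓝 0) :=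
    fun r hr => (isLittleO_log_rpow_atTop hr).tendsto_div_nhds_zero
  have hpow : ∀ r : ℝ, 0 < r → Tendsto (fun t : ℝ => 1 / t ^ r) atTop (𝓝 0) :=
    fun r hr => (tendsto_rpow_atTop hr).const_div_atTop 1
  have h := (((hlog 1 one_pos).add (hpow 1 one_pos)).const_mul c).add
    ((hlog (1 - d) (by linarith)).add (hpow (1 - d) (by linarith)))
  simp only [add_zero, mul_zero] at h
  refine (h.comp tendsto_natCast_atTop_atTop).congr' ?_
  filter_upwards [eventually_ge_atTop 1] with n hn
  have hn0 : (0 : ℝ) < n := by exact_mod_cast hn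
  simp only [Function.comp_apply, Real.rpow_sub hn0, Real.rpow_one]
  have : (0 : ℝ) < (n : ℝ) ^ d := by positivity
  field_simp

lemma tendsto_rpow_mul_log_one_add_div {γ a : ℝ} (hγ : 0 < γ) (ha : 0 ≤ a) :
    Tendsto (fun σ : ℝ => σ ^ γ * Real.log (1 + a / σ)) (𝓝[>] 0) (𝓝 0) := by
  have hpow : Tendsto (fun σ : ℝ => σ ^ γ) (𝓝[>] 0) (𝓝 0) := by
    have := (Real.continuousAt_rpow_const 0 γ (.inr hγ.le)).tendsto
    rw [Real.zero_rpow hγ.ne'] at this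
    exact this.mono_left nhdsWithin_le_nhds
  have h := (hpow.mul_const (Real.log (1 + a))).sub (tendsto_log_mul_rpow_nhdsGT_zero hγ)
  rw [zero_mul, sub_zero] at h
  refine squeeze_zero' ?_ ?_ h
  · filter_upwards [self_mem_nhdsWithin] with σ hσ
    replace hσ : 0 < σ := hσ
    exact mul_nonneg (by positivity) (log_one_add_div_nonneg ha hσ)
  · filter_upwards [self_mem_nhdsWithin, mem_nhdsWithin_of_mem_nhds (Iio_mem_nhds one_pos)]
      with σ hσ hσ1
    replace hσ : 0 < σ := hσ
    replace hσ1 : σ < 1 := hσ1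
    have hle : Real.log (1 + a / σ) ≤ Real.log (1 + a) - Real.log σ := by
      rw [← Real.log_div (by positivity) hσ.ne']
      refine Real.log_le_log (by positivity) ?_
      rw [add_div]
      have : 1 ≤ 1 / σ := (one_le_div hσ).2 hσ1.le
      linarith
    calc σ ^ γ * Real.log (1 + a / σ) ≤ σ ^ γ * (Real.log (1 + a) - Real.log σ) := by gcongr
      _ = _ := by ring

/-- The count splits in two. The part proportional to the radius is a positive power of `σ`, which
beats `log (1 + a / σ)`; the part `(log n + 1) / n` beats the bound `O(n ^ d)` on the logarithm that
the restriction on scales provides. -/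
lemma tendsto_hits_mul_log_of_scale_zero {x : ℕ → ℝ} {C : ℝ} (hC : 0 ≤ C)
    (hx : ∀ᶠ n : ℕ in atTop, ∀ a ℓ : ℝ, 0 < ℓ → ℓ ≤ 1 / 2 →
      (hits x n {y | |y - a| ≤ ℓ} : ℝ) ≤ C * (n * ℓ + Real.log n + 1))
    {c₀ d : ℝ} (hc₀ : 0 < c₀) (hd0 : 0 < d) (hd1 : d < 1)
    {ns : ℕ → ℕ} (hns : Tendsto ns atTop atTop) {μ σ : ℕ → ℝ}
    (hσc : ∀ᶠ k in atTop, c₀ * Real.exp (-((ns k : ℝ) ^ d)) ≤ σ k)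
    (hσ : Tendsto σ atTop (𝓝 0)) {v β η a : ℝ} (hv : 0 < v) (hη : 0 < η) (hβ : 1 < β)
    (ha : 0 ≤ a) :
    Tendsto (fun k => (hits x (ns k) {y | |y - μ k| ≤ tailRadius v β η (σ k)} : ℝ) / ns k *
      Real.log (1 + a / σ k)) atTop (𝓝 0) := by
  have hσ0 : ∀ᶠ k in atTop, 0 < σ k := hσc.mono fun k hk => lt_of_lt_of_le (by positivity) hk
  have hσ' : Tendsto σ atTop (𝓝[>] 0) := tendsto_nhdsWithin_iff.2 ⟨hσ, hσ0⟩
  have hγ : 0 < (β - 1) / β := div_pos (by linarith) (by linarith)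
  have hr : Tendsto (fun k => tailRadius v β η (σ k)) atTop (𝓝 0) := by
    have := ((Real.continuousAt_rpow_const 0 ((β - 1) / β) (.inr hγ.le)).tendsto.comp
      hσ).const_mul ((v / η) ^ (1 / β))
    rw [Real.zero_rpow hγ.ne', mul_zero] at this
    exact this
  have hA : Tendsto (fun k => C * (v / η) ^ (1 / β) *
      (σ k ^ ((β - 1) / β) * Real.log (1 + a / σ k))) atTop (𝓝 0) := by
    simpa using ((tendsto_rpow_mul_log_one_add_div hγ ha).comp hσ').const_mul
      (C * (v / η) ^ (1 / β))
  have hB : Tendsto (fun k => C * ((Real.log (ns k) + 1) / ns k *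
      (Real.log (1 + a / c₀) + (ns k : ℝ) ^ d))) atTop (𝓝 0) := by
    simpa using ((tendsto_log_mul_id_div (c := Real.log (1 + a / c₀)) hd1).comp hns).const_mul C
  refine squeeze_zero' ?_ ?_ (by simpa using hA.add hB)
  · filter_upwards [hσ0] with k hk
    exact mul_nonneg (by positivity) (log_one_add_div_nonneg ha hk)
  · filter_upwards [hσ0, hσc, hns.eventually hx, hns.eventually_ge_atTop 1,
      hr.eventually_le_const (show (0 : ℝ) < 1 / 2 by norm_num)] with k h0 hc hk hn1 hr2
    have hn : (1 : ℝ) ≤ ns k := by exact_mod_cast hn1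
    have hlog := log_one_add_div_nonneg ha h0
    have hcount := hk (μ k) _ (tailRadius_pos (β := β) hv hη h0) hr2
    have hlogle : Real.log (1 + a / σ k) ≤ Real.log (1 + a / c₀) + (ns k : ℝ) ^ d := by
      have he : 1 ≤ Real.exp ((ns k : ℝ) ^ d) := Real.one_le_exp (by positivity)
      rw [← Real.log_exp ((ns k : ℝ) ^ d), ← Real.log_mul (by positivity) (Real.exp_pos _).ne']
      refine Real.log_le_log (by positivity) ?_
      have h1 : a / σ k ≤ a / c₀ * Real.exp ((ns k : ℝ) ^ d) := by
        refine (div_le_div_of_nonneg_left ha (by positivity) hc).trans_eq ?_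
        rw [Real.exp_neg]
        field_simp
      rw [add_mul, one_mul]
      exact add_le_add he h1
    calc (hits x (ns k) {y | |y - μ k| ≤ tailRadius v β η (σ k)} : ℝ) / ns k *
          Real.log (1 + a / σ k)
        ≤ C * (ns k * tailRadius v β η (σ k) + Real.log (ns k) + 1) / ns k *
          Real.log (1 + a / σ k) := by gcongr
      _ = C * tailRadius v β η (σ k) * Real.log (1 + a / σ k) +
          C * ((Real.log (ns k) + 1) / ns k * Real.log (1 + a / σ k)) := by
          field_simp
          ring_nf
      _ ≤ _ := by
          refine add_le_add (le_of_eq ?_) ?_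
          · unfold tailRadius; ring_nf
          · have : 0 ≤ Real.log (ns k) := Real.log_nonneg hn
            gcongr

/-! ### Comparison of likelihoods -/

/-- Each new term costs a factor `1 + b i / τ`, since the sum to which it is added is at least `τ`.
-/
lemma log_add_sum_le {ι : Type*} (S : Finset ι) {A τ : ℝ} (hτ : 0 < τ) (hA : τ ≤ A) {b : ι → ℝ}
    (hb : ∀ i ∈ S, 0 ≤ b i) :
    Real.log (A + ∑ i ∈ S, b i) ≤ Real.log A + ∑ i ∈ S, Real.log (1 + b i / τ) := by
  classical
  induction S using Finset.induction_on with
  | empty => simp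
  | insert i S hi ih =>
    have hbi := hb i (Finset.mem_insert_self i S)
    have hS : 0 ≤ ∑ i ∈ S, b i :=
      Finset.sum_nonneg fun j hj => hb j (Finset.mem_insert_of_mem hj)
    have ih := ih fun j hj => hb j (Finset.mem_insert_of_mem hj)
    rw [Finset.sum_insert hi, Finset.sum_insert hi]
    have key : Real.log (A + (b i + ∑ i ∈ S, b i)) ≤
        Real.log (A + ∑ i ∈ S, b i) + Real.log (1 + b i / τ) := by
      rw [← Real.log_mul (by linarith) (by positivity)]
      refine Real.log_le_log (by linarith) ?_
      have : b i ≤ (A + ∑ i ∈ S, b i) * (b i / τ) := by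
        calc b i = τ * (b i / τ) := by field_simp
          _ ≤ _ := mul_le_mul_of_nonneg_right (by linarith) (by positivity)
      linarith
    linarith

/-- If the densities along a sequence of parameters are dominated by `g` plus degenerating
components, and `g + τ` has a smaller asymptotic log-likelihood than `θ₀`, then the likelihood of
these parameters cannot keep exceeding that of `θ₀`. -/
lemma false_of_likelihood_le (hf : ∀ m, IsDensity (f m)) {v₀ v₁ β : ℝ} (hv₁ : 0 < v₁)
    (hβ : 1 < β) (hv : ∀ m x, f m x ≤ v₀ ∧ (x ≠ 0 → f m x ≤ v₁ * |x| ^ (-β)))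
    {x : ℕ → ℝ} (hx0 : ∀ i, 0 < mixture f θ₀ (x i)) {I I₀ τ : ℝ} (hI : I < I₀) (hτ : 0 < τ)
    (h₀ : Tendsto (fun n : ℕ => (∑ i ∈ Finset.range n, Real.log (mixture f θ₀ (x i))) / n) atTop
      (𝓝 I₀))
    {g : ℝ → ℝ} (hg : ∀ y, 0 ≤ g y)
    (hgI : Tendsto (fun n : ℕ => (∑ i ∈ Finset.range n, Real.log (g (x i) + τ)) / n) atTop (𝓝 I))
    {ns : ℕ → ℕ} (hns : Tendsto ns atTop atTop) {u : ℕ → Param M}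
    (hu : ∀ᶠ k in atTop, u k ∈ paramSpace M) (S : Finset (Fin M))
    (hdom : ∀ᶠ k in atTop, ∀ y, mixture f (u k) y ≤
      g y + ∑ m ∈ S, locScale (f m) (loc (u k) m) (scale (u k) m) y)
    (hS : ∀ m ∈ S, Tendsto (fun k =>
      (hits x (ns k) {y | |y - loc (u k) m| ≤ tailRadius v₁ β (τ / (M + 1)) (scale (u k) m)} : ℝ) /
        ns k * Real.log (1 + v₀ / τ / scale (u k) m)) atTop (𝓝 0))
    (hlik : ∀ᶠ k in atTop, likelihood f x (ns k) θ₀ ≤ likelihood f x (ns k) (u k)) : False := by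
  have hlim := (hgI.comp hns).add (tendsto_finsetSum S hS)
  rw [Finset.sum_const_zero, add_zero] at hlim
  refine hI.not_ge (le_of_tendsto_of_tendsto (h₀.comp hns) hlim ?_)
  filter_upwards [hu, hdom, hlik] with k huk hdk hlk
  have hη : 0 < τ / (M + 1) := by positivity
  simp only [Function.comp_apply]
  simp_rw [div_mul_eq_mul_div]
  rw [← Finset.sum_div, ← add_div]
  refine div_le_div_of_nonneg_right ?_ (Nat.cast_nonneg _)
  have hlik0 : 0 < likelihood f x (ns k) θ₀ := Finset.prod_pos fun i _ => hx0 i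
  -- No factor may vanish: `Real.log 0 = 0` would spoil the comparison of log-likelihoods.
  have hpos : ∀ i ∈ Finset.range (ns k), mixture f (u k) (x i) ≠ 0 :=
    Finset.prod_ne_zero_iff.1 (hlik0.trans_le hlk).ne'
  have hlog : ∑ i ∈ Finset.range (ns k), Real.log (mixture f θ₀ (x i)) ≤
      ∑ i ∈ Finset.range (ns k), Real.log (mixture f (u k) (x i)) := by
    rw [← Real.log_prod fun i _ => (hx0 i).ne', ← Real.log_prod hpos]
    exact Real.log_le_log hlik0 hlk
  refine hlog.trans ?_
  simp_rw [← sum_indicator_eq_hits]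
  rw [Finset.sum_comm, ← Finset.sum_add_distrib]
  refine Finset.sum_le_sum fun i hi => ?_
  set b : Fin M → ℝ := fun m =>
    {y | |y - loc (u k) m| ≤ tailRadius v₁ β (τ / (M + 1)) (scale (u k) m)}.indicator
      (fun _ => v₀ / scale (u k) m) (x i) with hb
  have hv₀ : ∀ m, 0 ≤ v₀ := fun m => ((hf m).nonneg 0).trans (hv m 0).1
  have hb0 : ∀ m, 0 ≤ b m := fun m =>
    Set.indicator_nonneg (fun _ _ => div_nonneg (hv₀ m) (huk.2.2 m).le) _
  have hle : mixture f (u k) (x i) ≤ (g (x i) + τ) + ∑ m ∈ S, b m := by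
    have h1 : ∑ m ∈ S, locScale (f m) (loc (u k) m) (scale (u k) m) (x i) ≤
        ∑ m ∈ S, (τ / (M + 1) + b m) := Finset.sum_le_sum fun m _ =>
      locScale_le_add_indicator hv₁ hβ hη (huk.2.2 m) (hf m).nonneg (fun y => (hv m y).1)
        (fun y => (hv m y).2) (x i)
    -- The share `τ / (M + 1)` per component makes the errors outside the intervals add up to at
    -- most `τ`, the offset of `g`.
    have h2 : (S.card : ℝ) * (τ / (M + 1)) ≤ τ := by
      have : (S.card : ℝ) ≤ M := by
        have := S.card_le_univ
        rw [Fintype.card_fin] at this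
        exact_mod_cast this
      rw [← mul_div_assoc, div_le_iff₀ (by positivity)]
      nlinarith
    rw [Finset.sum_add_distrib, Finset.sum_const, nsmul_eq_mul] at h1
    linarith [hdk (x i)]
  have hmpos : 0 < mixture f (u k) (x i) :=
    (mixture_nonneg hf huk (x i)).lt_of_ne' (hpos i hi)
  refine (Real.log_le_log hmpos hle).trans ((log_add_sum_le S hτ (by linarith [hg (x i)])
    fun m _ => hb0 m).trans (le_of_eq ?_))
  congr 1
  refine Finset.sum_congr rfl fun m _ => ?_
  simp only [hb, Set.indicator_apply]
  split_ifs
  · rw [div_right_comm]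
  · simp

end LocScaleMixture

namespace LocScaleMixture

variable {M : ℕ} {f : Fin M → ℝ → ℝ} {θ θ₀ : Param M}

/-! ### Replacing degenerating components -/

/-- The parameter `θ` with the location and the scale of the components in `S` set to `0`
and `N`. -/
noncomputable def resetOn (S : Finset (Fin M)) (N : ℝ) (θ : Param M) : Param M :=
  WithLp.toLp 2 fun i => if i.1 ∈ S then ![θ (i.1, 0), 0, N] i.2 else θ i

lemma weight_resetOn (S : Finset (Fin M)) (N : ℝ) (θ : Param M) (m : Fin M) :
    weight (resetOn S N θ) m = weight θ m := by
  simp [weight, resetOn]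

lemma loc_resetOn_of_notMem {S : Finset (Fin M)} (N : ℝ) (θ : Param M) {m : Fin M} (hm : m ∉ S) :
    loc (resetOn S N θ) m = loc θ m := by
  simp [loc, resetOn, hm]

lemma scale_resetOn_of_notMem {S : Finset (Fin M)} (N : ℝ) (θ : Param M) {m : Fin M}
    (hm : m ∉ S) : scale (resetOn S N θ) m = scale θ m := by
  simp [scale, resetOn, hm]

lemma scale_resetOn_of_mem {S : Finset (Fin M)} (N : ℝ) (θ : Param M) {m : Fin M}
    (hm : m ∈ S) : scale (resetOn S N θ) m = N := by
  simp [scale, resetOn, hm]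

lemma resetOn_empty (N : ℝ) (θ : Param M) : resetOn ∅ N θ = θ := by
  ext i
  simp [resetOn]

lemma resetOn_mem_paramSpace (S : Finset (Fin M)) {N : ℝ} (hN : 0 < N) (hθ : θ ∈ paramSpace M) :
    resetOn S N θ ∈ paramSpace M := by
  refine ⟨by simpa only [weight_resetOn] using hθ.1, fun m => ?_, fun m => ?_⟩
  · rw [weight_resetOn]
    exact hθ.2.1 m
  · by_cases hm : m ∈ S
    · rwa [scale_resetOn_of_mem N θ hm]
    · rw [scale_resetOn_of_notMem N θ hm]
      exact hθ.2.2 m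

lemma tendsto_resetOn {S : Finset (Fin M)} {N : ℝ} {u : ℕ → Param M}
    (h : ∀ i : Fin M × Fin 3, (i.1 ∉ S ∨ i.2 = 0) →
      Tendsto (fun k => u k i) atTop (𝓝 (θ i))) :
    Tendsto (fun k => resetOn S N (u k)) atTop (𝓝 (resetOn S N θ)) := by
  refine ((PiLp.continuous_toLp 2 _).tendsto _).comp (tendsto_pi_nhds.2 fun i => ?_)
  by_cases hi : i.1 ∈ S
  · simp only [hi, if_true]
    obtain ⟨m, c⟩ := i
    fin_cases c
    · exact h (m, 0) (.inr rfl)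
    · exact tendsto_const_nhds
    · exact tendsto_const_nhds
  · simp only [hi, if_false]
    exact h i (.inl hi)

lemma mixture_resetOn (S : Finset (Fin M)) (N : ℝ) (θ : Param M) (x : ℝ) :
    mixture f (resetOn S N θ) x = subMixture f Sᶜ θ x +
      ∑ m ∈ S, weight θ m * locScale (f m) (loc (resetOn S N θ) m) N x := by
  unfold mixture subMixture
  rw [← Finset.sum_add_sum_compl S, add_comm]
  congr 1
  · refine Finset.sum_congr rfl fun m hm => ?_
    have hm := Finset.mem_compl.1 hm
    rw [weight_resetOn, loc_resetOn_of_notMem N θ hm, scale_resetOn_of_notMem N θ hm]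
  · refine Finset.sum_congr rfl fun m hm => ?_
    rw [weight_resetOn, scale_resetOn_of_mem N θ hm]

/-- The reset components are nonnegative and the weights at most one, so adding the original
components unweighted is enough. -/
lemma mixture_le_resetOn_add (hf : ∀ m, IsDensity (f m)) (hθ : θ ∈ paramSpace M)
    (S : Finset (Fin M)) {N : ℝ} (hN : 0 < N) (x : ℝ) :
    mixture f θ x ≤ mixture f (resetOn S N θ) x +
      ∑ m ∈ S, locScale (f m) (loc θ m) (scale θ m) x := by
  rw [mixture_resetOn]
  unfold mixture subMixture
  rw [← Finset.sum_add_sum_compl S, add_comm, add_assoc]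
  refine add_le_add le_rfl ?_
  rw [← Finset.sum_add_distrib]
  refine Finset.sum_le_sum fun m _ => ?_
  have h1 : weight θ m * locScale (f m) (loc θ m) (scale θ m) x ≤
      locScale (f m) (loc θ m) (scale θ m) x :=
    mul_le_of_le_one_left (locScale_nonneg (hf m) (hθ.2.2 m) x) (weight_le_one hθ m)
  have h2 := mul_nonneg (hθ.2.1 m)
    (locScale_nonneg (hf m) (μ := loc (resetOn S N θ) m) hN x)
  linarith

/-- If the true density needs all `M` components, then some choice of the scale of the replaced
components yields a density different from the true one. -/
lemma exists_resetOn_ne (hf : ∀ m, IsDensity (f m)) {v : ℝ} (hv : ∀ m x, f m x ≤ v)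
    (hθ : θ ∈ paramSpace M) {S : Finset (Fin M)} (hS : S.Nonempty)
    (hM : mixture f θ₀ ∉ mixtureClass f (M - 1)) :
    ∃ N : ℝ, 0 < N ∧ ¬ mixture f (resetOn S N θ) =ᵐ[volume] mixture f θ₀ := by
  by_contra! hcon
  refine hM ⟨Sᶜ, ?_, θ, hθ, ?_⟩
  · rw [Finset.card_compl, Fintype.card_fin]
    exact Nat.sub_le_sub_left hS.card_pos M
  -- If every scale gave the true density, letting the scale tend to infinity along the integers
  -- would make the reset components vanish pointwise and leave the true density as a mixture over
  -- `Sᶜ`.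
  have hall : ∀ᵐ x, ∀ k : ℕ, mixture f (resetOn S (k + 1) θ) x = mixture f θ₀ x :=
    ae_all_iff.2 fun k => hcon (k + 1) (by positivity)
  filter_upwards [hall] with x hx
  have hlim : Tendsto (fun k : ℕ => ∑ m ∈ S, weight θ m *
      locScale (f m) (loc (resetOn S ((k : ℝ) + 1) θ) m) (k + 1) x) atTop (𝓝 0) := by
    rw [← Finset.sum_const_zero (s := S)]
    refine tendsto_finsetSum S fun m _ => ?_
    rw [← mul_zero (weight θ m)]
    refine Tendsto.const_mul _ (squeeze_zero (fun k => locScale_nonneg (hf m) (by positivity) x)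
      (fun k => locScale_le (by positivity) (hv m) x) ?_)
    exact (tendsto_atTop_add_const_right _ _ tendsto_natCast_atTop_atTop).const_div_atTop v
  refine tendsto_nhds_unique (tendsto_const_nhds (f := (atTop : Filter ℕ))) ?_
  have h := hlim.const_add (subMixture f Sᶜ θ x)
  rw [add_zero] at h
  refine h.congr fun k => ?_
  rw [← mixture_resetOn, hx k]

/-! ### Consistency along a fixed sequence of observations -/

/-- The properties, valid for almost every sequence of observations, from which consistency
follows. The set `T` of centres, with the radii `ρ` and the offsets `τ`, comes from a countable
cover of the parameters with a density different from the true one. -/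
structure IsTypical (f : Fin M → ℝ → ℝ) (θ₀ : Param M) (T : Set (Param M)) (ρ τ : Param M → ℝ)
    (x : ℕ → ℝ) : Prop where
  pos : ∀ i, 0 < mixture f θ₀ (x i)
  log_true : Tendsto (fun n : ℕ => (∑ i ∈ Finset.range n, Real.log (mixture f θ₀ (x i))) / n) atTop
    (𝓝 (∫ y, Real.log (mixture f θ₀ y) ∂(mixtureLaw f θ₀)))
  log_ballSup : ∀ θ ∈ T, Tendsto
    (fun n : ℕ => (∑ i ∈ Finset.range n, Real.log (ballSup f θ (ρ θ) (x i) + τ θ)) / n) atTop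
    (𝓝 (∫ y, Real.log (ballSup f θ (ρ θ) y + τ θ) ∂(mixtureLaw f θ₀)))
  tails : ∃ p : ℕ → ℝ, Tendsto p atTop (𝓝 0) ∧ ∀ A : ℕ,
    Tendsto (fun n : ℕ => (hits x n {y | (A : ℝ) < |y|} : ℝ) / n) atTop (𝓝 (p A))
  short : ∃ C : ℝ, 0 ≤ C ∧ ∀ᶠ n : ℕ in atTop, ∀ a ℓ : ℝ, 0 < ℓ → ℓ ≤ 1 / 2 →
    (hits x n {y | |y - a| ≤ ℓ} : ℝ) ≤ C * (n * ℓ + Real.log n + 1)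

lemma tendsto_coord_of_ereal {u : ℕ → Param M} {w : Fin M × Fin 3 → EReal} {i : Fin M × Fin 3}
    (hu : Tendsto (fun k => (u k i : EReal)) atTop (𝓝 (w i))) (ht : w i ≠ ⊤) (hb : w i ≠ ⊥) :
    Tendsto (fun k => u k i) atTop (𝓝 (w i).toReal) := by
  exact (EReal.tendsto_toReal ht hb).comp hu

lemma eventually_mem_restrictedSpace (hθ : θ ∈ paramSpace M) {c₀ d : ℝ} (hd0 : 0 < d) :
    ∀ᶠ n : ℕ in atTop, θ ∈ restrictedSpace M c₀ d n := by
  have h : Tendsto (fun n : ℕ => c₀ * Real.exp (-((n : ℝ) ^ d))) atTop (𝓝 0) := by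
    have := (Real.tendsto_exp_neg_atTop_nhds_zero.comp ((tendsto_rpow_atTop hd0).comp
      tendsto_natCast_atTop_atTop)).const_mul c₀
    simpa using this
  have : ∀ᶠ n : ℕ in atTop, ∀ m, c₀ * Real.exp (-((n : ℝ) ^ d)) ≤ scale θ m :=
    eventually_all.2 fun m => h.eventually_le_const (hθ.2.2 m)
  exact this.mono fun n hn => ⟨hθ, hn⟩

open Classical in
theorem tendsto_setDist_of_isTypical (hf : ∀ m, IsDensity (f m)) (hθ₀ : θ₀ ∈ paramSpace M)
    (h1 : TailBound f) (hM : mixture f θ₀ ∉ mixtureClass f (M - 1))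
    {c₀ d : ℝ} (hc₀ : 0 < c₀) (hd0 : 0 < d) (hd1 : d < 1)
    {T : Set (Param M)} {ρ τ : Param M → ℝ}
    (hcover : ∀ θ ∈ paramSpace M, ¬ mixture f θ =ᵐ[volume] mixture f θ₀ →
      ∃ θ' ∈ T, θ ∈ Metric.ball θ' (ρ θ'))
    (hT : ∀ θ ∈ T, 0 < τ θ ∧
      (∀ x, ∀ θ' ∈ paramSpace M, dist θ' θ ≤ ρ θ → mixture f θ' x ≤ ballSup f θ (ρ θ) x) ∧
      ∫ x, Real.log (ballSup f θ (ρ θ) x + τ θ) ∂(mixtureLaw f θ₀) <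
        ∫ x, Real.log (mixture f θ₀ x) ∂(mixtureLaw f θ₀))
    {x : ℕ → ℝ} (hx : IsTypical f θ₀ T ρ τ x) {θhat : ℕ → Param M}
    (hmle : ∀ᶠ n in atTop, IsMLE f (restrictedSpace M c₀ d n) x n (θhat n)) :
    Tendsto (fun n => setDist (equivParams f (θhat n)) (equivParams f θ₀)) atTop (𝓝 0) := by
  obtain ⟨v₀, v₁, β, hv₀, hv₁, hβ, hv⟩ := h1
  refine tendsto_of_subseq_tendsto fun ns' hns' => ?_
  -- Compactness of a finite power of `EReal`; it suffices to treat one such subsequence.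
  obtain ⟨w, φ, hφ, hw⟩ := CompactSpace.tendsto_subseq
    (fun k => (fun i => (θhat (ns' k) i : EReal) : Fin M × Fin 3 → EReal))
  refine ⟨φ, ?_⟩
  set ns : ℕ → ℕ := fun k => ns' (φ k)
  have hns : Tendsto ns atTop atTop := hns'.comp hφ.tendsto_atTop
  set u : ℕ → Param M := fun k => θhat (ns k)
  replace hw : ∀ i, Tendsto (fun k => (u k i : EReal)) atTop (𝓝 (w i)) := tendsto_pi_nhds.1 hw
  have hmle' : ∀ᶠ k in atTop, IsMLE f (restrictedSpace M c₀ d (ns k)) x (ns k) (u k) :=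
    hns.eventually hmle
  have hu : ∀ᶠ k in atTop, u k ∈ paramSpace M := hmle'.mono fun k hk => hk.1.1
  set S : Finset (Fin M) := Finset.univ.filter fun m =>
    w (m, 2) = 0 ∨ w (m, 2) = ⊤ ∨ w (m, 1) = ⊤ ∨ w (m, 1) = ⊥ with hS
  have hα0 : ∀ m, 0 ≤ w (m, 0) := fun m => ge_of_tendsto (hw (m, 0))
    (hu.mono fun k hk => EReal.coe_nonneg.2 (hk.2.1 m))
  have hα1 : ∀ m, w (m, 0) ≤ 1 := fun m => le_of_tendsto (hw (m, 0))
    (hu.mono fun k hk => EReal.coe_le_coe_iff.2 (weight_le_one hk m))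
  have hσ0 : ∀ m, 0 ≤ w (m, 2) := fun m => ge_of_tendsto (hw (m, 2))
    (hu.mono fun k hk => EReal.coe_nonneg.2 (hk.2.2 m).le)
  set θ₁ : Param M := WithLp.toLp 2 fun i => if i.1 ∈ S ∧ i.2 ≠ 0 then 1 else (w i).toReal
    with hθ₁def
  have hcoord : ∀ i : Fin M × Fin 3, (i.1 ∉ S ∨ i.2 = 0) →
      Tendsto (fun k => u k i) atTop (𝓝 (θ₁ i)) := by
    intro i hi
    have hif : θ₁ i = (w i).toReal := by
      simp only [hθ₁def]
      exact if_neg (by tauto)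
    rw [hif]
    have h0 : ∀ m, w (m, 0) ≠ ⊤ ∧ w (m, 0) ≠ ⊥ := fun m =>
      ⟨((hα1 m).trans_lt (EReal.coe_lt_top 1)).ne, ((EReal.bot_lt_coe 0).trans_le (hα0 m)).ne'⟩
    obtain ⟨m, c⟩ := i
    by_cases hc : c = 0
    · subst hc
      exact tendsto_coord_of_ereal (hw _) (h0 m).1 (h0 m).2
    · have hm : m ∉ S := hi.resolve_right hc
      simp only [hS, Finset.mem_filter, Finset.mem_univ, true_and, not_or] at hm
      have h2 : w (m, 2) ≠ ⊥ := ((EReal.bot_lt_coe 0).trans_le (hσ0 m)).ne'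
      fin_cases c
      · exact absurd rfl hc
      · exact tendsto_coord_of_ereal (hw _) hm.2.2.1 hm.2.2.2
      · exact tendsto_coord_of_ereal (hw _) hm.2.1 h2
  have hθ₁ : θ₁ ∈ paramSpace M := by
    refine ⟨?_, fun m => ?_, fun m => ?_⟩
    · refine tendsto_nhds_unique
        (tendsto_finsetSum Finset.univ fun m _ => hcoord (m, 0) (.inr rfl)) ?_
      exact tendsto_const_nhds.congr' (hu.mono fun k hk => hk.1.symm)
    · exact ge_of_tendsto (hcoord (m, 0) (.inr rfl)) (hu.mono fun k hk => hk.2.1 m)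
    · by_cases hm : m ∈ S
      · simp [scale, hθ₁def, hm]
      · have hm' := hm
        simp only [hS, Finset.mem_filter, Finset.mem_univ, true_and, not_or] at hm'
        have : scale θ₁ m = (w (m, 2)).toReal := by simp [scale, hθ₁def, hm]
        rw [this]
        exact EReal.toReal_pos ((hσ0 m).lt_of_ne' hm'.1) hm'.2.1
  -- In the good case the estimator itself and `θ₁` witness the small distance; the other case is
  -- contradictory.
  by_cases hgood : S = ∅ ∧ mixture f θ₁ =ᵐ[volume] mixture f θ₀
  · have hlim : Tendsto u atTop (𝓝 θ₁) := by
      have := tendsto_resetOn (N := 1) hcoord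
      simpa only [hgood.1, resetOn_empty] using this
    refine tendsto_of_tendsto_of_tendsto_of_le_of_le' tendsto_const_nhds
      (tendsto_iff_edist_tendsto_0.1 hlim) (.of_forall fun _ => zero_le)
      (hu.mono fun k hk => ?_)
    exact iInf₂_le_of_le (u k) ⟨hk, .rfl⟩ (iInf₂_le θ₁ ⟨hθ₁, hgood.2⟩)
  exfalso
  obtain ⟨N, hN, hNne⟩ : ∃ N : ℝ, 0 < N ∧
      ¬ mixture f (resetOn S N θ₁) =ᵐ[volume] mixture f θ₀ := by
    rcases S.eq_empty_or_nonempty with hSe | hSn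
    · refine ⟨1, one_pos, ?_⟩
      rw [hSe, resetOn_empty]
      exact fun h => hgood ⟨hSe, h⟩
    · exact exists_resetOn_ne hf (fun m y => (hv m y).1) hθ₁ hSn hM
  obtain ⟨θ', hθ'T, hθ'⟩ := hcover _ (resetOn_mem_paramSpace S hN hθ₁) hNne
  obtain ⟨hτ, hsup, hI⟩ := hT θ' hθ'T
  have hball : ∀ᶠ k in atTop, resetOn S N (u k) ∈ Metric.ball θ' (ρ θ') :=
    (tendsto_resetOn hcoord).eventually (Metric.isOpen_ball.mem_nhds hθ')
  have ha : 0 ≤ v₀ / τ θ' := by positivity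
  have hη : 0 < τ θ' / (M + 1) := by positivity
  refine false_of_likelihood_le hf hv₁ hβ hv hx.pos hI hτ hx.log_true
    (ballSup_nonneg hf (ρ θ')) (hx.log_ballSup θ' hθ'T) hns hu S ?_ (fun m hm => ?_) ?_
  · filter_upwards [hu, hball] with k hk hkb y
    exact (mixture_le_resetOn_add hf hk S hN y).trans
      (add_le_add_left (hsup y _ (resetOn_mem_paramSpace S hN hk) hkb.le) _)
  · have hσpos : ∀ᶠ k in atTop, 0 < scale (u k) m := hu.mono fun k hk => hk.2.2 m
    have hwσ := hw (m, 2)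
    simp only [hS, Finset.mem_filter, Finset.mem_univ, true_and] at hm
    by_cases htop : w (m, 2) = ⊤
    · rw [htop, EReal.tendsto_coe_nhds_top_iff] at hwσ
      exact tendsto_hits_mul_log_of_scale_atTop x ha hσpos hwσ
    by_cases hzero : w (m, 2) = 0
    · obtain ⟨C, hC, hshort⟩ := hx.short
      rw [hzero, ← EReal.coe_zero, EReal.tendsto_coe] at hwσ
      exact tendsto_hits_mul_log_of_scale_zero hC hshort hc₀ hd0 hd1 hns
        (hmle'.mono fun k hk => hk.1.2 m) hwσ hv₁ hη hβ ha
    · obtain ⟨p, hp, htails⟩ := hx.tails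
      have hpos : 0 < (w (m, 2)).toReal := EReal.toReal_pos ((hσ0 m).lt_of_ne' hzero) htop
      have hσlim : Tendsto (fun k => scale (u k) m) atTop (𝓝 (w (m, 2)).toReal) :=
        tendsto_coord_of_ereal hwσ htop ((EReal.bot_lt_coe 0).trans_le (hσ0 m)).ne'
      have hμ : Tendsto (fun k => |loc (u k) m|) atTop atTop := by
        have hwμ := hw (m, 1)
        rcases (show w (m, 1) = ⊤ ∨ w (m, 1) = ⊥ by tauto) with h | h
        · rw [h, EReal.tendsto_coe_nhds_top_iff] at hwμ
          exact tendsto_abs_atTop_atTop.comp hwμ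
        · rw [h, EReal.tendsto_coe_nhds_bot_iff] at hwμ
          exact tendsto_abs_atBot_atTop.comp hwμ
      refine tendsto_hits_mul_log_of_loc_atTop hp htails hns ?_ hpos hσlim hμ ha
      exact continuousAt_const.mul (Real.continuousAt_rpow_const _ _ (.inl hpos.ne'))
  · filter_upwards [hmle', hns.eventually (eventually_mem_restrictedSpace hθ₀ hd0)] with k hk hk₀
    exact hk.2 θ₀ hk₀

/-! ### Typical observations -/

theorem ae_isTypical (hf : ∀ m, IsDensity (f m)) (hθ₀ : θ₀ ∈ paramSpace M) (h1 : TailBound f)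
    (h4 : LogIntegrable f θ₀) {T : Set (Param M)} (hTc : T.Countable) {ρ τ : Param M → ℝ}
    (hT : ∀ θ ∈ T,
      Integrable (fun x => Real.log (ballSup f θ (ρ θ) x + τ θ)) (mixtureLaw f θ₀))
    {Ω : Type*} [MeasurableSpace Ω] {P : Measure Ω} {X : ℕ → Ω → ℝ} (hindep : iIndepFun X P)
    (hlaw : ∀ i, HasLaw (X i) (mixtureLaw f θ₀) P) :
    ∀ᵐ ω ∂P, IsTypical f θ₀ T ρ τ fun i => X i ω := by
  have := isProbabilityMeasure_mixtureLaw hf hθ₀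
  obtain ⟨v₀, v₁, β, hv₀, hv₁, hβ, hv⟩ := h1
  obtain ⟨s, hs, hθs⟩ := exists_scale_lower_bound hθ₀
  -- The maximum with `1` is taken because `ae_eventually_hits_le` asks for a density bound of at
  -- least one.
  have hB : ∀ x, mixture f θ₀ x ≤ max 1 (v₀ / s) := fun x =>
    (mixture_le (fun m y => (hv m y).1) hv₀.le hs hθ₀ hθs x).trans (le_max_right _ _)
  have hmeas : ∀ A : ℕ, MeasurableSet {y : ℝ | (A : ℝ) < |y|} := fun A =>
    measurableSet_lt measurable_const measurable_id.abs
  have htails : ∀ᵐ ω ∂P, ∀ A : ℕ,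
      Tendsto (fun n : ℕ => (hits (fun i => X i ω) n {y | (A : ℝ) < |y|} : ℝ) / n) atTop
        (𝓝 ((mixtureLaw f θ₀).real {y | (A : ℝ) < |y|})) := by
    refine ae_all_iff.2 fun A => ?_
    filter_upwards [ae_tendsto_average hindep hlaw
      ((integrable_const (1 : ℝ)).indicator (hmeas A))] with ω hω
    simp_rw [sum_indicator_eq_hits (fun i => X i ω), mul_one] at hω
    rwa [integral_indicator_const _ (hmeas A), smul_eq_mul, mul_one] at hω
  have hp : Tendsto (fun A : ℕ => (mixtureLaw f θ₀).real {y | (A : ℝ) < |y|}) atTop (𝓝 0) := by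
    have h := tendsto_measure_iInter_atTop (μ := mixtureLaw f θ₀)
      (fun A : ℕ => (hmeas A).nullMeasurableSet)
      (fun A B hAB y (hy : (B : ℝ) < |y|) =>
        show (A : ℝ) < |y| from (Nat.cast_le.2 hAB).trans_lt hy)
      ⟨0, measure_ne_top _ _⟩
    have hempty : ⋂ A : ℕ, {y : ℝ | (A : ℝ) < |y|} = ∅ := by
      refine Set.eq_empty_iff_forall_notMem.2 fun y hy => ?_
      obtain ⟨A, hA⟩ := exists_nat_ge |y|
      exact (lt_irrefl _) ((Set.mem_iInter.1 hy A : (A : ℝ) < |y|).trans_le hA)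
    rw [hempty, measure_empty] at h
    exact (ENNReal.tendsto_toReal ENNReal.zero_ne_top).comp h
  filter_upwards [ae_of_hasLaw hlaw (mixture_pos_ae hf hθ₀),
    ae_tendsto_average hindep hlaw (integrable_log_mixture hf hθ₀ h4),
    (ae_ball_iff hTc).2 fun θ hθ => ae_tendsto_average hindep hlaw (hT θ hθ), htails,
    ae_eventually_hits_le hindep hlaw (le_max_left 1 (v₀ / s))
      fun s hs => mixtureLaw_le hB hs] with ω a b c d e
  exact ⟨a, b, c, ⟨_, hp, d⟩, ⟨32 * max 1 (v₀ / s), by positivity, e⟩⟩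

end LocScaleMixture

/-! ### Strong consistency of the restricted maximum likelihood estimator -/

theorem theorem2 {M : ℕ} (f : Fin M → ℝ → ℝ)
    (hdens : ∀ m, LocScaleMixture.IsDensity (f m))
    (θ₀ : LocScaleMixture.Param M) (hθ₀ : θ₀ ∈ LocScaleMixture.paramSpace M)
    (h1 : LocScaleMixture.TailBound f)
    (h2 : LocScaleMixture.SupMeasurable f)
    (h3 : LocScaleMixture.ParamContinuous f)
    (h4 : LocScaleMixture.LogIntegrable f θ₀)
    (hM : LocScaleMixture.mixture f θ₀ ∈
      LocScaleMixture.mixtureClass f M \ LocScaleMixture.mixtureClass f (M - 1))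
    (c₀ d : ℝ) (hc₀ : 0 < c₀) (hd0 : 0 < d) (hd1 : d < 1)
    {Ω : Type*} [MeasurableSpace Ω] (P : Measure Ω) [IsProbabilityMeasure P]
    (X : ℕ → Ω → ℝ) (hindep : iIndepFun X P)
    (hlaw : ∀ i, HasLaw (X i) (LocScaleMixture.mixtureLaw f θ₀) P)
    (θhat : ℕ → Ω → LocScaleMixture.Param M) :
    ∀ᵐ ω ∂P,
      (∀ᶠ n in atTop, LocScaleMixture.IsMLE f (LocScaleMixture.restrictedSpace M c₀ d n)
        (fun i => X i ω) n (θhat n ω)) →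
      Tendsto (fun n => LocScaleMixture.setDist
        (LocScaleMixture.equivParams f (θhat n ω)) (LocScaleMixture.equivParams f θ₀))
        atTop (𝓝 0) := by
  set D : Set (LocScaleMixture.Param M) := {θ | θ ∈ LocScaleMixture.paramSpace M ∧
    ¬ LocScaleMixture.mixture f θ =ᵐ[volume] LocScaleMixture.mixture f θ₀}
  choose! ρ τ hρτ using fun θ (hθ : θ ∈ D) =>
    LocScaleMixture.exists_ballSup_integral_log_lt hdens hθ₀ h1 h2 h3 h4 hθ.1 hθ.2
  -- By the Lindelöf property countably many balls cover all wrong densities, so the null sets from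
  -- the law of large numbers have a null union that does not depend on the estimators.
  obtain ⟨T, hTD, hTc, hcover⟩ := TopologicalSpace.countable_cover_nhdsWithin (s := D)
    (f := fun θ => Metric.ball θ (ρ θ))
    fun θ hθ => mem_nhdsWithin_of_mem_nhds (Metric.ball_mem_nhds θ (hρτ θ hθ).1)
  have htyp := LocScaleMixture.ae_isTypical hdens hθ₀ h1 h4 hTc (ρ := ρ) (τ := τ)
    (fun θ hθ => (hρτ θ (hTD hθ)).2.2.2.2.1) hindep hlaw
  filter_upwards [htyp] with ω hω hmle
  refine LocScaleMixture.tendsto_setDist_of_isTypical hdens hθ₀ h1 hM.2 hc₀ hd0 hd1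
    (fun θ hθ hne => ?_) (fun θ hθ => ?_) hω hmle
  · simpa using hcover (show θ ∈ D from ⟨hθ, hne⟩)
  · obtain ⟨-, h5, -, h6, -, h7⟩ := hρτ θ (hTD hθ)
    exact ⟨h5, h6, h7⟩
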